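/- Let Sol be $\mathbb R^3$ with coordinates $(x,y,z)$ and the Riemannian metric $e^{2z}dx^2+e^{-2z}dy^2+dz^2$, and let $P=\{x=0\}$, a totally geodesic surface isometric to the hyperbolic plane. Let $c>1$ and let $\Gamma\subset P$ be a circle of curvature $c$, that is, a smooth closed embedded curve in $P$ with constant geodesic curvature $c$. Let $M$ be a compact smooth surface with boundary and $f:M\to\mathrm{Sol}$ a smooth immersion that restricts to a diffeomorphism $\partial M\to\Gamma$. If $f$ has constant mean curvature $H$ (half the trace of the shape operator with respect to a smooth unit normal field along $f$), then $$|H|\le \frac{c+1}{c-1}\cdot\frac{c+\sqrt{c^2-1}}{2}.$$ -/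

import Mathlib

open scoped Manifold ContDiff

namespace SolGeometry

noncomputable section

/-- The underlying manifold `ℝ³` of Sol, with coordinates `x = p 0`, `y = p 1`, `z = p 2`.
The tangent space at every point is identified with `ℝ³` through the coordinate frame
`∂/∂x, ∂/∂y, ∂/∂z`.  (The norm that `Fin 3 → ℝ` carries is never used as a metric below; it only
gives the standard smooth structure.) -/
abbrev Sol : Type := Fin 3 → ℝ

/-- The Riemannian metric `e^{2z} dx² + e^{-2z} dy² + dz²` of Sol, at the point `p`. -/
def metric (p u v : Sol) : ℝ :=
  Real.exp (2 * p 2) * (u 0 * v 0) + Real.exp (-(2 * p 2)) * (u 1 * v 1) + u 2 * v 2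

/-- The length of a tangent vector `u` at `p`. -/
def length (p u : Sol) : ℝ := Real.sqrt (metric p u u)

/-- The Christoffel symbols of the Levi-Civita connection in the coordinates `(x, y, z)`:
`christoffel p u v = ∑ Γⁱⱼₖ(p) uʲ vᵏ ∂ᵢ`, so that `∇_u V = D_u V + christoffel p u V`. -/
def christoffel (p u v : Sol) : Sol :=
  ![u 0 * v 2 + u 2 * v 0,
    -(u 1 * v 2 + u 2 * v 1),
    -(Real.exp (2 * p 2) * (u 0 * v 0)) + Real.exp (-(2 * p 2)) * (u 1 * v 1)]

/-- The connection is torsion free. -/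
theorem christoffel_symm (p u v : Sol) : christoffel p u v = christoffel p v u := by
  unfold christoffel
  congr 1
  · ring
  · congr 1
    · ring
    · congr 1
      ring

/-- The connection is compatible with the metric; with `christoffel_symm` this says that it is
the Levi-Civita connection of `metric`. -/
theorem christoffel_compatible (p u v w : Sol) :
    HasDerivAt (fun t : ℝ => metric (p + t • w) u v)
      (metric p (christoffel p w u) v + metric p u (christoffel p w v)) 0 := by
  have h1 : HasDerivAt (fun t : ℝ => 2 * (p 2 + t * w 2)) (2 * w 2) 0 := by
    simpa using (((hasDerivAt_id (0 : ℝ)).mul_const (w 2)).const_add (p 2)).const_mul 2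
  have h2 := (h1.exp.mul_const (u 0 * v 0)).add (h1.neg.exp.mul_const (u 1 * v 1))
  have h3 := h2.add_const (u 2 * v 2)
  have hval : Real.exp (2 * p 2) * Real.exp (-(2 * p 2)) = 1 := by
    rw [← Real.exp_add]; simp
  refine HasDerivAt.congr_deriv (f := fun t : ℝ => metric (p + t • w) u v) h3 ?_
  simp only [metric, christoffel, Matrix.cons_val_zero, Matrix.cons_val_one, Matrix.cons_val,
    zero_mul, add_zero, Pi.neg_apply]
  ring

/-- The totally geodesic plane `P = {x = 0}`. -/
def planeP : Set Sol := {p | p 0 = 0}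

/-- The covariant acceleration `∇_{α'} α'` of a curve in Sol. -/
def covAcceleration (α : ℝ → Sol) (s : ℝ) : Sol :=
  deriv (deriv α) s + christoffel (α s) (deriv α s) (deriv α s)

/-- For a smooth curve in `P` the covariant acceleration in Sol is tangent to `P`, that is, it is
the intrinsic covariant acceleration of the curve in the Riemannian surface `P`; hence its length
is the intrinsic (geodesic) curvature in `P` if the curve has unit speed. -/
theorem covAcceleration_tangent {α : ℝ → Sol} (hα : ContDiff ℝ ∞ α) (hP : ∀ s, α s ∈ planeP)
    (s : ℝ) : covAcceleration α s 0 = 0 := by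
  have h0 : (fun s => α s 0) = fun _ => (0 : ℝ) := funext hP
  have hd : ∀ s, deriv α s 0 = 0 := by
    intro s
    have h := hasDerivAt_pi.1 ((hα.differentiable (by simp)) s).hasDerivAt 0
    rw [h0] at h
    exact h.unique (hasDerivAt_const s 0)
  have hα' : ContDiff ℝ ∞ (deriv α) := (contDiff_infty_iff_deriv.1 hα).2
  have hdd : deriv (deriv α) s 0 = 0 := by
    have h := hasDerivAt_pi.1 ((hα'.differentiable (by simp)) s).hasDerivAt 0
    rw [show (fun s => deriv α s 0) = fun _ => (0 : ℝ) from funext hd] at h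
    exact h.unique (hasDerivAt_const s 0)
  simp [covAcceleration, christoffel, hd, hdd]

/-- `Γ` is a circle of curvature `c` in the hyperbolic plane `P`: a smooth closed embedded curve
contained in `P` whose geodesic curvature is constant, equal to `c`.  Here `α` is a periodic
parametrization by arc length. -/
def IsCircleInP (c : ℝ) (Γ : Set Sol) : Prop :=
  ∃ (α : ℝ → Sol) (T : ℝ), 0 < T ∧ ContDiff ℝ ∞ α ∧ Function.Periodic α T ∧
    Set.InjOn α (Set.Ico 0 T) ∧ Set.range α = Γ ∧
    (∀ s, α s ∈ planeP) ∧
    (∀ s, length (α s) (deriv α s) = 1) ∧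
    (∀ s, length (α s) (covAcceleration α s) = c)

section Immersion

variable {E : Type*} [NormedAddCommGroup E] [NormedSpace ℝ E] {K : Type*} [TopologicalSpace K]
  (I : ModelWithCorners ℝ E K) {M : Type*} [TopologicalSpace M] [ChartedSpace K M]

/-- The differential at `p` of a map `f : M → Sol`, with values in `ℝ³`. -/
def differential (f : M → Sol) (p : M) (v : TangentSpace I p) : Sol :=
  mfderiv I 𝓘(ℝ, Sol) f p v

/-- A smooth immersion `M → Sol` (of a manifold possibly with boundary). -/
def IsSmoothImmersion (f : M → Sol) : Prop :=
  ContMDiff I 𝓘(ℝ, Sol) ∞ f ∧ ∀ p, Function.Injective (differential I f p)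

/-- The covariant derivative `∇_v V` of a vector field `V` along `f : M → Sol` in the direction of
a tangent vector `v` of `M` at `p`. -/
def covDerivAlong (f V : M → Sol) (p : M) (v : TangentSpace I p) : Sol :=
  differential I V p v + christoffel (f p) (differential I f p v) (V p)

/-- `N` is a smooth unit normal field (Gauss map) along `f : M → Sol`. -/
def IsUnitNormal (f N : M → Sol) : Prop :=
  ContMDiff I 𝓘(ℝ, Sol) ∞ N ∧
    (∀ p, length (f p) (N p) = 1) ∧
    ∀ p (v : TangentSpace I p), metric (f p) (N p) (differential I f p v) = 0

/-- `S` is the shape operator (Weingarten endomorphism) at `p` of the immersion `f` with unit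
normal `N`: `df (S v) = -∇_v N`.  It is determined by `f` and `N`, since `df` is injective. -/
def IsShapeOperatorAt (f N : M → Sol) (p : M)
    (S : TangentSpace I p →ₗ[ℝ] TangentSpace I p) : Prop :=
  ∀ v, differential I f p (S v) = -covDerivAlong I f N p v

/-- The immersed surface `f` (`M` of dimension two) has, with respect to the unit normal `N`,
mean curvature `H` at `p`: half of the trace of its shape operator is `H`. -/
def HasMeanCurvatureAt (f N : M → Sol) (p : M) (H : ℝ) : Prop :=
  ∃ S : TangentSpace I p →ₗ[ℝ] TangentSpace I p,
    IsShapeOperatorAt I f N p S ∧ LinearMap.trace ℝ (TangentSpace I p) S / 2 = H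

/-- The immersed surface `f` has constant mean curvature `H` (for some choice of unit normal). -/
def HasConstantMeanCurvature (f : M → Sol) (H : ℝ) : Prop :=
  ∃ N : M → Sol, IsUnitNormal I f N ∧ ∀ p, HasMeanCurvatureAt I f N p H

/-- The immersed surface `f` spans `Γ`, i.e. `Γ` is its boundary: `f` maps `∂M` bijectively onto `Γ`.  As `f`
is a smooth immersion, `∂M` is compact and `Γ` is an embedded curve, `f : ∂M → Γ` is then a
diffeomorphism. -/
def Spans (f : M → Sol) (Γ : Set Sol) : Prop :=
  Set.BijOn f (I.boundary M) Γ

end Immersion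

end

end SolGeometry

open scoped Manifold ContDiff

namespace SolGeometry

open Real MeasureTheory Set Filter Topology

/-! The proof is a flux argument for the Killing field `∂/∂x`. The volume form of Sol is `dx ∧ dy ∧
dz`, since `e^z · e^{-z} = 1`. Contracting it with `∂/∂x` and the unit normal `N` gives, up to sign,
`N₁ dz - N₂ dy`, which on the boundary measures the component of `∂/∂x` along the conormal.
Contracting it with `∂/∂x` alone gives `dy ∧ dz = d(y dz)`. On a surface of constant mean curvature
`H` the form `(N₁ + 2H y) dz - N₂ dy` is therefore closed (`wedge_flux`), and Stokes' theorem
(`integral_boundary_eq_zero`) yields `2H ∫ y dz = -∫ (N₁ dz - N₂ dy)` along `Γ`.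

The right-hand side is at most `∫ e^z ds` in absolute value, because `e^z` is the length of `∂/∂x`
(`abs_flux_le`). For the left-hand side, put `w = e^z`: then `P` is the upper half-plane with metric
`(dy² + dw²)/w²`, `Γ` is a Euclidean circle, `∫ e^z ds` is its Euclidean length, and `|∫ y dz| = l ∫
e^z ds` with `l = c - √(c² - 1)` (`abs_integral_eq_of_circle`). Hence `2|H| l ≤ 1`, that is `|H| ≤
(c + √(c² - 1))/2`. The factor `(c+1)/(c-1) ≥ 1` is slack.

Stokes' theorem for an abstract compact surface is derived from Green's formula in half-plane
charts, with a partition of unity. The unit normal orients every chart through the sign of `det(N,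
∂₁f, ∂₂f)`, so no oriented atlas is needed. -/

/-! ### Circles in the hyperbolic plane -/

/-- The Euclidean length and the flux of a hyperbolic circle, from its Frenet equations. -/
theorem integral_eq_of_frenet {c l T : ℝ} (hc : 1 < c) (hl0 : 0 < l) (hl1 : l < 1)
    (hl : l ^ 2 + 1 = 2 * c * l) {u z x Z : ℝ → ℝ}
    (hu : ∀ s, HasDerivAt u (exp (z s) * x s) s) (hz : ∀ s, HasDerivAt z (Z s) s)
    (hx : ∀ s, HasDerivAt x (Z s * (x s - c)) s) (hZ : ∀ s, HasDerivAt Z (x s * (c - x s)) s)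
    (hunit : ∀ s, x s ^ 2 + Z s ^ 2 = 1) (hzT : z T = z 0) (hxT : x T = x 0) (hZT : Z T = Z 0) :
    ∫ s in (0 : ℝ)..T, u s * Z s = l * ∫ s in (0 : ℝ)..T, exp (z s) := by
  have hx1 : ∀ s, x s ≤ 1 := fun s => by nlinarith [hunit s, sq_nonneg (Z s)]
  have cu : Continuous u := continuous_iff_continuousAt.2 fun s => (hu s).continuousAt
  have cz : Continuous z := continuous_iff_continuousAt.2 fun s => (hz s).continuousAt
  have cZ : Continuous Z := continuous_iff_continuousAt.2 fun s => (hZ s).continuousAt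
  -- The two first integrals `c - x = b e^z` and `b u = Z - d` say that in the coordinates `(u,
  -- e^z)` the curve lies on a Euclidean circle of radius `1/|b|`.
  obtain ⟨b, hb⟩ : ∃ b, ∀ s, c - x s = b * exp (z s) := by
    refine ⟨(c - x 0) * exp (-z 0), fun s => ?_⟩
    have h : ∀ s, HasDerivAt (fun s => (c - x s) * exp (-z s)) 0 s := fun s => by
      refine (((hx s).const_sub c).mul (hz s).fun_neg.exp).congr_deriv ?_
      ring
    have h1 : (c - x s) * exp (-z s) = (c - x 0) * exp (-z 0) :=
      is_const_of_deriv_eq_zero (fun s => (h s).differentiableAt) (fun s => (h s).deriv) s 0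
    rw [← h1, mul_assoc, ← exp_add, neg_add_cancel, exp_zero, mul_one]
  obtain ⟨d, hd⟩ : ∃ d, ∀ s, b * u s = Z s - d := by
    refine ⟨Z 0 - b * u 0, fun s => ?_⟩
    have h : ∀ s, HasDerivAt (fun s => Z s - b * u s) 0 s := fun s => by
      refine ((hZ s).sub ((hu s).const_mul b)).congr_deriv ?_
      rw [hb s]; ring
    have h1 : Z s - b * u s = Z 0 - b * u 0 :=
      is_const_of_deriv_eq_zero (fun s => (h s).differentiableAt) (fun s => (h s).deriv) s 0
    linarith
  have hb0 : b ≠ 0 := by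
    rintro rfl
    have := hb 0; have := hx1 0; linarith
  have hden : ∀ s, 0 < 1 - l * x s := fun s => by nlinarith [hx1 s]
  -- The arctangent is minus the argument of `1 - l (x + iZ)`, which is single-valued because `l <
  -- 1`. The primitive thus depends only on `x`, `Z` and `z`, and takes equal values at `0` and `T`.
  have hprim : ∀ s, HasDerivAt
      (fun s => (c - l) * (2 * arctan (l * Z s / (1 - l * x s))) - Z s + d * z s)
      (b * (l * exp (z s) - u s * Z s)) s := fun s => by
    have hcx : 0 < c - x s := by linarith [hx1 s]
    have e2 : 1 + (l * Z s / (1 - l * x s)) ^ 2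
        = 2 * l * (c - x s) / (1 - l * x s) ^ 2 := by
      have := (hden s).ne'
      field_simp
      linear_combination l ^ 2 * hunit s + hl
    have h1 : HasDerivAt (fun s => 2 * arctan (l * Z s / (1 - l * x s))) (x s - l) s := by
      refine ((((hZ s).const_mul l).div (((hx s).const_mul l).const_sub 1)
        (hden s).ne').arctan.const_mul 2).congr_deriv ?_
      simp only [Pi.div_apply]
      rw [e2]
      have := (hden s).ne'
      field_simp
      linear_combination (-l * (c - x s)) * hunit s
    refine (((h1.const_mul (c - l)).sub (hZ s)).add ((hz s).const_mul d)).congr_deriv ?_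
    have e1 : b * (l * exp (z s) - u s * Z s) = l * (c - x s) - (Z s - d) * Z s := by
      rw [← hd s, hb s]; ring
    rw [e1]
    linear_combination hunit s + hl
  have hint := intervalIntegral.integral_eq_sub_of_hasDerivAt (a := 0) (b := T)
    (fun s _ => hprim s) (by apply Continuous.intervalIntegrable; fun_prop)
  rw [hzT, hxT, hZT, sub_self, intervalIntegral.integral_const_mul,
    intervalIntegral.integral_sub (by apply Continuous.intervalIntegrable; fun_prop)
      (by apply Continuous.intervalIntegrable; fun_prop), intervalIntegral.integral_const_mul] at hint
  have := (mul_eq_zero.1 hint).resolve_left hb0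
  linarith


/-- For a circle of curvature `c` parametrized by arc length, the flux `∫ y dz` through it is the
Euclidean length `∫ e^z ds`, up to the factor `l = c - √(c² - 1)`. -/
theorem abs_integral_eq_of_circle {c l T : ℝ} (hc : 1 < c) (hl0 : 0 < l) (hl1 : l < 1)
    (hl : l ^ 2 + 1 = 2 * c * l) {α : ℝ → Sol} (hα : ContDiff ℝ ∞ α) (hT : 0 ≤ T)
    (hper : Function.Periodic α T) (hP : ∀ s, α s ∈ planeP)
    (hunit : ∀ s, length (α s) (deriv α s) = 1)
    (hcurv : ∀ s, length (α s) (covAcceleration α s) = c) :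
    |∫ s in (0 : ℝ)..T, α s 1 * deriv α s 2| = l * ∫ s in (0 : ℝ)..T, exp (α s 2) := by
  have hα' : ContDiff ℝ ∞ (deriv α) := (contDiff_infty_iff_deriv.1 hα).2
  have hα'' : ContDiff ℝ ∞ (deriv (deriv α)) := (contDiff_infty_iff_deriv.1 hα').2
  have d1 : ∀ s i, HasDerivAt (fun s => α s i) (deriv α s i) s := fun s i =>
    hasDerivAt_pi.1 ((hα.differentiable (by simp)) s).hasDerivAt i
  have d2 : ∀ s i, HasDerivAt (fun s => deriv α s i) (deriv (deriv α) s i) s := fun s i =>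
    hasDerivAt_pi.1 ((hα'.differentiable (by simp)) s).hasDerivAt i
  have h0 : ∀ s, deriv α s 0 = 0 := fun s => by
    have h := d1 s 0
    rw [show (fun s => α s 0) = fun _ => (0 : ℝ) from funext hP] at h
    exact h.unique (hasDerivAt_const s 0)
  have ha0 := covAcceleration_tangent hα hP
  -- `(X, Z)` and `(A, B)` are the components of the velocity and of the covariant acceleration in
  -- the orthonormal frame `e^z ∂/∂y`, `∂/∂z` of `P`.
  set X : ℝ → ℝ := fun s => exp (-α s 2) * deriv α s 1 with hX
  set Z : ℝ → ℝ := fun s => deriv α s 2 with hZ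
  set A : ℝ → ℝ := fun s => exp (-α s 2) * (deriv (deriv α) s 1 - 2 * (deriv α s 1 * deriv α s 2))
    with hA
  set B : ℝ → ℝ := fun s => deriv (deriv α) s 2 + X s ^ 2 with hB
  clear_value X Z A B
  have hexp : ∀ s, exp (-(2 * α s 2)) = exp (-α s 2) ^ 2 := fun s => by
    rw [← exp_nat_mul]; congr 1; push_cast; ring
  have hXZ : ∀ s, X s ^ 2 + Z s ^ 2 = 1 := fun s => by
    have h := hunit s
    rw [length, Real.sqrt_eq_one, metric, h0 s, hexp] at h
    simp only [hX, hZ]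
    linear_combination h
  have hAB : ∀ s, A s ^ 2 + B s ^ 2 = c ^ 2 := fun s => by
    have h := hcurv s
    rw [length, Real.sqrt_eq_iff_mul_self_eq_of_pos (by linarith), metric, ha0 s, hexp] at h
    simp only [covAcceleration, christoffel, Pi.add_apply, Matrix.cons_val_one, Matrix.cons_val,
      Matrix.cons_val_zero, h0 s, hexp] at h
    simp only [hA, hB, hX]
    linear_combination -h
  have dX : ∀ s, HasDerivAt X (A s + X s * Z s) s := fun s => by
    rw [hX]
    refine ((d1 s 2).fun_neg.exp.mul (d2 s 1)).congr_deriv ?_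
    simp only [hA, hZ]; ring
  have dZ : ∀ s, HasDerivAt Z (B s - X s ^ 2) s := fun s => by
    rw [hZ]
    refine (d2 s 2).congr_deriv ?_
    simp only [hB]; ring
  have horth : ∀ s, X s * A s + Z s * B s = 0 := fun s => by
    have h : HasDerivAt (fun s => X s ^ 2 + Z s ^ 2) (2 * (X s * A s + Z s * B s)) s := by
      refine (((dX s).pow 2).add ((dZ s).pow 2)).congr_deriv ?_
      ring
    rw [show (fun s => X s ^ 2 + Z s ^ 2) = fun _ => (1 : ℝ) from funext hXZ] at h
    linarith [h.unique (hasDerivAt_const s 1)]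
  have cα : ∀ i, Continuous fun s => α s i := fun i => (continuous_apply i).comp hα.continuous
  have cα' : ∀ i, Continuous fun s => deriv α s i :=
    fun i => (continuous_apply i).comp hα'.continuous
  have cα'' : ∀ i, Continuous fun s => deriv (deriv α) s i :=
    fun i => (continuous_apply i).comp hα''.continuous
  have cX : Continuous X := hX ▸ (cα 2).neg.rexp.mul (cα' 1)
  have cZ : Continuous Z := hZ ▸ cα' 2
  have cA : Continuous A := 
    hA ▸ (cα 2).neg.rexp.mul ((cα'' 1).sub (continuous_const.mul ((cα' 1).mul (cα' 2))))
  have cB : Continuous B := hB ▸ (cα'' 2).add (cX.pow 2)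
  have hsq : ∀ s, (X s * B s - Z s * A s) ^ 2 = c ^ 2 := fun s => by
    linear_combination (A s ^ 2 + B s ^ 2) * hXZ s + hAB s - (X s * A s + Z s * B s) * horth s
  -- The signed curvature is continuous with constant square `c² > 0`, so its sign `e` is constant
  -- along the curve.
  obtain ⟨e, he, hk⟩ : ∃ e : ℝ, e * e = 1 ∧ ∀ s, X s * B s - Z s * A s = e * c := by
    have cf : Continuous fun s => X s * B s - Z s * A s := (cX.mul cB).sub (cZ.mul cA)
    have hs : EqOn ((fun s => X s * B s - Z s * A s) ^ 2) ((fun _ => c) ^ 2) univ :=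
      fun s _ => hsq s
    rcases isPreconnected_univ.eq_or_eq_neg_of_sq_eq cf.continuousOn continuousOn_const hs
      (fun _ => by positivity) with h | h
    · exact ⟨1, by ring, fun s => by simpa using h (mem_univ s)⟩
    · exact ⟨-1, by ring, fun s => by simpa using h (mem_univ s)⟩
  have eA : ∀ s, A s = -(e * c) * Z s := fun s => by
    linear_combination -Z s * hk s + X s * horth s - A s * hXZ s
  have eB : ∀ s, B s = e * c * X s := fun s => by
    linear_combination X s * hk s + Z s * horth s - B s * hXZ s
  have hαT : ∀ i, α T i = α 0 i := fun i => by
    have := hper 0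
    rw [zero_add] at this
    rw [this]
  have hdT : ∀ i, deriv α T i = deriv α 0 i := fun i => by
    have : deriv α (0 + T) = deriv α 0 := by
      rw [← deriv_comp_add_const, show (fun s => α (s + T)) = α from funext hper]
    rw [zero_add] at this
    rw [this]
  -- If `e = -1`, the reflection `y ↦ -y` makes the signed curvature positive; multiplying `y` and
  -- `X` by `e` covers both cases.
  have key := integral_eq_of_frenet (T := T) hc hl0 hl1 hl (u := fun s => e * α s 1)
    (z := fun s => α s 2) (x := fun s => e * X s) (Z := Z)
    (fun s => ((d1 s 1).const_mul e).congr_deriv (by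
      simp only [hX]
      rw [show exp (α s 2) * (e * (exp (-α s 2) * deriv α s 1))
        = e * deriv α s 1 * (exp (α s 2) * exp (-α s 2)) by ring, ← exp_add]
      simp))
    (fun s => (d1 s 2).congr_deriv (by rw [hZ]))
    (fun s => ((dX s).const_mul e).congr_deriv (by
      rw [eA]; linear_combination (-c * Z s) * he))
    (fun s => (dZ s).congr_deriv (by
      rw [eB]; linear_combination (X s ^ 2) * he))
    (fun s => by linear_combination hXZ s + X s ^ 2 * he)
    (hαT 2) (by simp only [hX, hαT, hdT]) (by simp only [hZ, hdT])
  have hpos : 0 ≤ l * ∫ s in (0 : ℝ)..T, exp (α s 2) :=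
    mul_nonneg hl0.le (intervalIntegral.integral_nonneg hT fun s _ => (exp_pos _).le)
  simp only [mul_assoc, hZ, intervalIntegral.integral_const_mul] at key
  rw [← abs_of_nonneg hpos, ← key, abs_mul]
  have : |e| = 1 := by
    rcases mul_self_eq_one_iff.1 he with h | h <;> simp [h]
  rw [this, one_mul]

/-! ### Green's formula in the half-plane -/

/-- A relatively open subset of the closed half-plane `{u | 0 ≤ u.1}`. -/
def IsHalfOpen (D : Set (ℝ × ℝ)) : Prop :=
  ∃ O : Set (ℝ × ℝ), IsOpen O ∧ D = O ∩ {u | 0 ≤ u.1}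

theorem isClosed_halfPlane : IsClosed {u : ℝ × ℝ | 0 ≤ u.1} :=
  isClosed_le continuous_const continuous_fst

theorem interior_halfPlane : interior {u : ℝ × ℝ | 0 ≤ u.1} = {u | 0 < u.1} := by
  rw [show {u : ℝ × ℝ | 0 ≤ u.1} = Prod.fst ⁻¹' Ici 0 from rfl,
    ← isOpenMap_fst.preimage_interior_eq_interior_preimage continuous_fst, interior_Ici]
  rfl

theorem uniqueDiffOn_halfPlane : UniqueDiffOn ℝ {u : ℝ × ℝ | 0 ≤ u.1} := by
  refine uniqueDiffOn_convex ?_ ⟨(1, 0), ?_⟩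
  · exact (convex_Ici (0 : ℝ)).linear_preimage (LinearMap.fst ℝ ℝ ℝ)
  · rw [interior_halfPlane]; simp

namespace IsHalfOpen

variable {D : Set (ℝ × ℝ)}

theorem subset (hD : IsHalfOpen D) : D ⊆ {u | 0 ≤ u.1} := by
  obtain ⟨O, -, rfl⟩ := hD
  exact inter_subset_right

theorem measurableSet (hD : IsHalfOpen D) : MeasurableSet D := by
  obtain ⟨O, hO, rfl⟩ := hD
  exact hO.measurableSet.inter isClosed_halfPlane.measurableSet

theorem uniqueDiffOn (hD : IsHalfOpen D) : UniqueDiffOn ℝ D := by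
  obtain ⟨O, hO, rfl⟩ := hD
  rw [inter_comm]
  exact uniqueDiffOn_halfPlane.inter hO

theorem nhdsWithin_eq (hD : IsHalfOpen D) {u : ℝ × ℝ} (hu : u ∈ D) :
    𝓝[D] u = 𝓝[{u | 0 ≤ u.1}] u := by
  obtain ⟨O, hO, rfl⟩ := hD
  rw [inter_comm]
  exact nhdsWithin_inter_of_mem' (mem_nhdsWithin_of_mem_nhds (hO.mem_nhds hu.1))

theorem mem_nhds (hD : IsHalfOpen D) {u : ℝ × ℝ} (hu : u ∈ D) (hu0 : 0 < u.1) : D ∈ 𝓝 u := by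
  obtain ⟨O, hO, rfl⟩ := hD
  exact inter_mem (hO.mem_nhds hu.1)
    (mem_of_superset ((isOpen_lt continuous_const continuous_fst).mem_nhds hu0)
      fun v hv => (show (0 : ℝ) < v.1 from hv).le)

theorem isOpen_slice (hD : IsHalfOpen D) : IsOpen {t : ℝ | ((0 : ℝ), t) ∈ D} := by
  obtain ⟨O, hO, rfl⟩ := hD
  have : {t : ℝ | ((0 : ℝ), t) ∈ O ∩ {u : ℝ × ℝ | 0 ≤ u.1}} = (fun t => ((0 : ℝ), t)) ⁻¹' O := by
    ext t; simp
  rw [this]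
  exact hO.preimage (by fun_prop)

end IsHalfOpen

/-- Near a point outside `D` the extension is identically zero, since the compact set `K ⊆ D` is
closed in the plane. This makes functions on a chart domain extendable to a box. -/
theorem continuousOn_indicator_halfPlane {D K : Set (ℝ × ℝ)} (hD : IsHalfOpen D)
    (hK : IsCompact K) (hKD : K ⊆ D) {φ : ℝ × ℝ → ℝ} (hφ : ContinuousOn φ D) (h0 : ∀ u ∈ D, u ∉ K → φ u = 0) :
    ContinuousOn (D.indicator φ) {u | 0 ≤ u.1} := by
  intro u hu
  by_cases huD : u ∈ D
  · rw [ContinuousWithinAt, ← hD.nhdsWithin_eq huD, indicator_of_mem huD]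
    exact (hφ u huD).congr' (eventually_mem_nhdsWithin.mono fun v hv => (indicator_of_mem hv φ).symm)
  · by_cases huK : u ∈ K
    · exact absurd (hKD huK) huD
    · have : D.indicator φ =ᶠ[𝓝 u] fun _ => 0 := by
        filter_upwards [hK.isClosed.isOpen_compl.mem_nhds huK] with v hv
        by_cases hvD : v ∈ D
        · rw [indicator_of_mem hvD, h0 v hvD hv]
        · exact indicator_of_notMem hvD _
      exact (continuousAt_const.congr this.symm).continuousWithinAt

theorem fderivWithin_eq_zero_of_notMem {D K : Set (ℝ × ℝ)}
    (hK : IsCompact K) {φ : ℝ × ℝ → ℝ} (h0 : ∀ u ∈ D, u ∉ K → φ u = 0) {u : ℝ × ℝ} (hu : u ∈ D)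
    (huK : u ∉ K) : fderivWithin ℝ φ D u = 0 := by
  have : φ =ᶠ[𝓝[D] u] fun _ => 0 := by
    filter_upwards [mem_nhdsWithin_of_mem_nhds (hK.isClosed.isOpen_compl.mem_nhds huK),
      self_mem_nhdsWithin] with v hv hvD using h0 v hvD hv
  rw [this.fderivWithin_eq (h0 u hu huK)]
  simp

/-- The coefficient of `dg ∧ dh` with respect to `du.1 ∧ du.2`. -/
noncomputable def wedge (D : Set (ℝ × ℝ)) (g h : ℝ × ℝ → ℝ) (u : ℝ × ℝ) : ℝ :=
  fderivWithin ℝ g D u (1, 0) * fderivWithin ℝ h D u (0, 1) -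
    fderivWithin ℝ g D u (0, 1) * fderivWithin ℝ h D u (1, 0)

theorem continuousOn_wedge {D : Set (ℝ × ℝ)} (hD : IsHalfOpen D) {g h : ℝ × ℝ → ℝ}
    (hg : ContDiffOn ℝ ∞ g D) (hh : ContDiffOn ℝ ∞ h D) : ContinuousOn (wedge D g h) D := by
  have h1 := hg.continuousOn_fderivWithin hD.uniqueDiffOn (by simp)
  have h2 := hh.continuousOn_fderivWithin hD.uniqueDiffOn (by simp)
  unfold wedge
  fun_prop

/-- Green's formula on a relatively open subset of the half-plane. -/
theorem integral_wedge {D K : Set (ℝ × ℝ)} (hD : IsHalfOpen D) (hK : IsCompact K) (hKD : K ⊆ D)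
    {g h : ℝ × ℝ → ℝ} (hg : ContDiffOn ℝ ∞ g D) (hh : ContDiffOn ℝ ∞ h D)
    (h0 : ∀ u ∈ D, u ∉ K → g u = 0) :
    ∫ u in D, wedge D g h u =
      -∫ t in {t : ℝ | ((0 : ℝ), t) ∈ D}, g (0, t) * fderivWithin ℝ h D (0, t) (0, 1) := by
  -- `V v` is `g ∂_v h` extended by zero. In the divergence of `(V (0,1), -V (1,0))` the second
  -- derivatives of `h` cancel by symmetry, which leaves the coefficient of `dg ∧ dh`.
  set V : ℝ × ℝ → ℝ × ℝ → ℝ := fun v => D.indicator fun u => g u * fderivWithin ℝ h D u v with hV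
  have hh' : ContDiffOn ℝ ∞ (fderivWithin ℝ h D) D := hh.fderivWithin hD.uniqueDiffOn (by simp)
  have cV : ∀ v, ContinuousOn (V v) {u | 0 ≤ u.1} := fun v =>
    continuousOn_indicator_halfPlane hD hK hKD
      (hg.continuousOn.mul (hh'.continuousOn.clm_apply continuousOn_const))
      fun u hu huK => by rw [h0 u hu huK, zero_mul]
  have V0 : ∀ v u, u ∉ K → V v u = 0 := fun v u huK => by
    by_cases hu : u ∈ D
    · simp [hV, indicator_of_mem hu, h0 u hu huK]
    · simp [hV, indicator_of_notMem hu]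
  have w0 : ∀ u ∈ D, u ∉ K → wedge D g h u = 0 := fun u hu huK => by
    simp [wedge, fderivWithin_eq_zero_of_notMem hK h0 hu huK]
  set W := D.indicator (wedge D g h) with hW
  have W0 : ∀ u, u ∉ K → W u = 0 := fun u huK => by
    by_cases hu : u ∈ D
    · rw [hW, indicator_of_mem hu, w0 u hu huK]
    · rw [hW, indicator_of_notMem hu]
  have cW : ContinuousOn W {u | 0 ≤ u.1} :=
    continuousOn_indicator_halfPlane hD hK hKD (continuousOn_wedge hD hg hh) w0
  have dV : ∀ u : ℝ × ℝ, 0 < u.1 → (∀ v, DifferentiableAt ℝ (V v) u) ∧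
      fderiv ℝ (V (0, 1)) u (1, 0) - fderiv ℝ (V (1, 0)) u (0, 1) = W u := by
    intro u hu0
    by_cases hu : u ∈ D
    · have hnhds := hD.mem_nhds hu hu0
      have hgu : ContDiffAt ℝ ∞ g u := hg.contDiffAt hnhds
      have hhu : ContDiffAt ℝ ∞ h u := hh.contDiffAt hnhds
      have hh'u : ContDiffAt ℝ ∞ (fderivWithin ℝ h D) u := hh'.contDiffAt hnhds
      have hg1 := (hgu.differentiableAt (by simp)).hasFDerivAt
      have hh1 := (hh'u.differentiableAt (by simp)).hasFDerivAt
      have heq : ∀ v, V v =ᶠ[𝓝 u] fun u => g u * fderivWithin ℝ h D u v := fun v => by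
        filter_upwards [hnhds] with w hw
        simp [hV, indicator_of_mem hw]
      have hd : ∀ v, HasFDerivAt (V v) _ u := fun v =>
        (hg1.mul (hh1.clm_apply (hasFDerivAt_const v u))).congr_of_eventuallyEq (heq v)
      refine ⟨fun v => (hd v).differentiableAt, ?_⟩
      have hsymm : ∀ v w, fderiv ℝ (fderivWithin ℝ h D) u v w
          = fderiv ℝ (fderivWithin ℝ h D) u w v := by
        have : fderivWithin ℝ h D =ᶠ[𝓝 u] fderiv ℝ h := by
          filter_upwards [eventually_mem_nhds_iff.2 hnhds] with w hw
            using fderivWithin_of_mem_nhds hw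
        rw [this.fderiv_eq]
        exact hhu.isSymmSndFDerivAt (by simpa using ENat.LEInfty.out (m := 2))
      rw [(hd _).fderiv, (hd _).fderiv, hW, indicator_of_mem hu, wedge,
        fderivWithin_of_mem_nhds (f := g) hnhds]
      simp [hsymm (1, 0) (0, 1)]
      ring
    · have huK : u ∉ K := fun h => hu (hKD h)
      have heq : ∀ v, V v =ᶠ[𝓝 u] fun _ => 0 := fun v => by
        filter_upwards [hK.isClosed.isOpen_compl.mem_nhds huK] with w hw using V0 v w hw
      refine ⟨fun v => ((differentiableAt_const 0).congr_of_eventuallyEq (heq v)), ?_⟩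
      rw [(heq _).fderiv_eq, (heq _).fderiv_eq, W0 u huK]
      simp
  obtain ⟨R, hR⟩ : ∃ R, K ⊆ Metric.ball 0 R := hK.isBounded.subset_ball 0
  have hR' : ∀ u : ℝ × ℝ, u ∈ K → |u.1| < R ∧ |u.2| < R := fun u hu => by
    have := hR hu
    rw [mem_ball_zero_iff, Prod.norm_def, max_lt_iff] at this
    simpa using this
  rcases K.eq_empty_or_nonempty with rfl | ⟨u₀, hu₀⟩
  · rw [setIntegral_eq_zero_of_forall_eq_zero fun u hu => w0 u hu (by simp),
      setIntegral_eq_zero_of_forall_eq_zero fun t ht => ?_, neg_zero]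
    rw [h0 _ ht (by simp), zero_mul]
  have hRpos : 0 < R := (abs_nonneg _).trans_lt (hR' u₀ hu₀).1
  have hIcc : Icc ((0 : ℝ), -R) (R, R) ⊆ {u | 0 ≤ u.1} := fun u hu => hu.1.1
  -- Differentiability is required only inside the box. Where `u.1 ≤ 0` the derivatives are filled
  -- in so that the divergence still equals `W`, which is continuous up to the edge. Only the edge
  -- `u.1 = 0` contributes, as the box contains `K` strictly on the other three sides.
  have key := integral_divergence_prod_Icc_of_hasFDerivAt_off_countable_of_le (V (0, 1))
    (fun u => -V (1, 0) u)
    (fun u => if 0 < u.1 then fderiv ℝ (V (0, 1)) u else W u • ContinuousLinearMap.fst ℝ ℝ ℝ)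
    (fun u => if 0 < u.1 then -fderiv ℝ (V (1, 0)) u else 0) (0, -R) (R, R)
    ⟨hRpos.le, by simpa using hRpos.le⟩ ∅ countable_empty ((cV _).mono hIcc) ((cV _).mono hIcc).neg
    (fun u hu => by
      have hu0 : 0 < u.1 := hu.1.1.1
      rw [if_pos hu0]; exact ((dV u hu0).1 _).hasFDerivAt)
    (fun u hu => by
      have hu0 : 0 < u.1 := hu.1.1.1
      rw [if_pos hu0]; exact ((dV u hu0).1 _).hasFDerivAt.neg)
  have hdiv : (fun u : ℝ × ℝ => (if 0 < u.1 then fderiv ℝ (V (0, 1)) u else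
      W u • ContinuousLinearMap.fst ℝ ℝ ℝ) (1, 0) +
      (if 0 < u.1 then -fderiv ℝ (V (1, 0)) u else 0) (0, 1)) = W := by
    funext u
    split_ifs with hu0
    · rw [← (dV u hu0).2]; simp [sub_eq_add_neg]
    · simp
  rw [hdiv] at key
  replace key := key ((cW.mono hIcc).integrableOn_compact isCompact_Icc)
  have e1 : ∀ x, V (1, 0) (x, R) = 0 := fun x => V0 _ _ fun hx => by
    have := (hR' _ hx).2
    rw [abs_of_pos hRpos] at this; exact lt_irrefl _ this
  have e2 : ∀ x, V (1, 0) (x, -R) = 0 := fun x => V0 _ _ fun hx => by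
    have := (hR' _ hx).2
    rw [abs_neg, abs_of_pos hRpos] at this; exact lt_irrefl _ this
  have e3 : ∀ y, V (0, 1) (R, y) = 0 := fun y => V0 _ _ fun hx => by
    have := (hR' _ hx).1
    rw [abs_of_pos hRpos] at this; exact lt_irrefl _ this
  simp only [e1, e2, e3, neg_zero, intervalIntegral.integral_zero, sub_self, zero_add, zero_sub]
    at key
  rw [← integral_indicator hD.measurableSet, ← setIntegral_eq_integral_of_forall_compl_eq_zero
    (s := Icc ((0 : ℝ), -R) (R, R)), key, intervalIntegral.integral_of_le (by linarith),
    ← integral_indicator hD.isOpen_slice.measurableSet]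
  · congr 1
    rw [setIntegral_eq_integral_of_forall_compl_eq_zero]
    · refine integral_congr_ae (ae_of_all _ fun t => ?_)
      simp [hV, indicator]
    · intro t ht
      refine V0 _ _ fun hx => ht ?_
      have := abs_lt.1 (hR' _ hx).2
      exact ⟨this.1, this.2.le⟩
  · intro u hu
    refine W0 u fun hx => hu ?_
    have h1 := abs_lt.1 (hR' _ hx).2
    have h2 := abs_lt.1 (hR' _ hx).1
    exact ⟨⟨hD.subset (hKD hx), h1.1.le⟩, ⟨h2.2.le, h1.2.le⟩⟩

/-! ### Local parametrizations of a surface with boundary -/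

/-- The plane `ℝ × ℝ` as the model space of surfaces. -/
noncomputable def planeEquiv : (ℝ × ℝ) ≃L[ℝ] EuclideanSpace ℝ (Fin 2) :=
  (ContinuousLinearEquiv.finTwoArrow ℝ ℝ).symm.trans (EuclideanSpace.equiv (Fin 2) ℝ).symm

section Charts

variable {M : Type*} [TopologicalSpace M] [ChartedSpace (EuclideanHalfSpace 2) M]

/-- The domain of the local parametrization of a surface around `p`. -/
def chartDomain (p : M) : Set (ℝ × ℝ) := planeEquiv ⁻¹' (extChartAt (𝓡∂ 2) p).target

/-- The local parametrization of a surface around `p`. -/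
noncomputable def chartPar (p : M) (u : ℝ × ℝ) : M := (extChartAt (𝓡∂ 2) p).symm (planeEquiv u)

/-- The local coordinates of a surface around `p`. -/
noncomputable def chartCoord (p q : M) : ℝ × ℝ := planeEquiv.symm (extChartAt (𝓡∂ 2) p q)

theorem isHalfOpen_chartDomain (p : M) : IsHalfOpen (chartDomain p) := by
  refine ⟨planeEquiv ⁻¹' ((𝓡∂ 2).symm ⁻¹' (chartAt (EuclideanHalfSpace 2) p).target),
    ((chartAt _ p).open_target.preimage (𝓡∂ 2).continuous_symm).preimage planeEquiv.continuous, ?_⟩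
  rw [chartDomain, extChartAt_target, preimage_inter, range_modelWithCornersEuclideanHalfSpace]
  rfl

theorem chartPar_mem (p : M) {u : ℝ × ℝ} (hu : u ∈ chartDomain p) :
    chartPar p u ∈ (chartAt (EuclideanHalfSpace 2) p).source := by
  rw [← extChartAt_source (𝓡∂ 2)]
  exact (extChartAt (𝓡∂ 2) p).map_target hu

theorem chartCoord_mem {p q : M} (hq : q ∈ (chartAt (EuclideanHalfSpace 2) p).source) :
    chartCoord p q ∈ chartDomain p := by
  rw [← extChartAt_source (𝓡∂ 2)] at hq
  simpa [chartDomain, chartCoord] using (extChartAt (𝓡∂ 2) p).map_source hq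

theorem chartCoord_chartPar {p : M} {u : ℝ × ℝ} (hu : u ∈ chartDomain p) :
    chartCoord p (chartPar p u) = u := by
  rw [chartCoord, chartPar, (extChartAt (𝓡∂ 2) p).right_inv hu]
  simp

theorem chartPar_chartCoord {p q : M} (hq : q ∈ (chartAt (EuclideanHalfSpace 2) p).source) :
    chartPar p (chartCoord p q) = q := by
  rw [← extChartAt_source (𝓡∂ 2)] at hq
  rw [chartCoord, chartPar, ContinuousLinearEquiv.apply_symm_apply,
    (extChartAt (𝓡∂ 2) p).left_inv hq]

theorem continuousOn_chartPar (p : M) : ContinuousOn (chartPar p) (chartDomain p) :=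
  (continuousOn_extChartAt_symm p).comp planeEquiv.continuous.continuousOn fun _ h => h

theorem continuousOn_chartCoord (p : M) :
    ContinuousOn (chartCoord p) (chartAt (EuclideanHalfSpace 2) p).source := by
  refine planeEquiv.symm.continuous.comp_continuousOn ?_
  rw [← extChartAt_source (𝓡∂ 2)]
  exact continuousOn_extChartAt p

variable [IsManifold (𝓡∂ 2) ∞ M]

theorem contDiffOn_comp_chartPar (p : M) {F : Type*} [NormedAddCommGroup F] [NormedSpace ℝ F]
    {a : M → F} (ha : ContMDiff (𝓡∂ 2) 𝓘(ℝ, F) ∞ a) :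
    ContDiffOn ℝ ∞ (a ∘ chartPar p) (chartDomain p) := by
  have h1 : ContMDiffOn 𝓘(ℝ, EuclideanSpace ℝ (Fin 2)) 𝓘(ℝ, F) ∞
      (a ∘ (extChartAt (𝓡∂ 2) p).symm) (extChartAt (𝓡∂ 2) p).target :=
    ha.comp_contMDiffOn (contMDiffOn_extChartAt_symm p)
  exact (contMDiffOn_iff_contDiffOn.1 h1).comp planeEquiv.contDiff.contDiffOn fun _ h => h

theorem contDiffOn_chartTransition (p q : M) :
    ContDiffOn ℝ ∞ (chartCoord q ∘ chartPar p)
      (chartDomain p ∩ chartPar p ⁻¹' (chartAt (EuclideanHalfSpace 2) q).source) := by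
  have h1 : ContMDiffOn 𝓘(ℝ, EuclideanSpace ℝ (Fin 2)) 𝓘(ℝ, EuclideanSpace ℝ (Fin 2)) ∞
      (extChartAt (𝓡∂ 2) q ∘ (extChartAt (𝓡∂ 2) p).symm)
      ((extChartAt (𝓡∂ 2) p).target ∩ (extChartAt (𝓡∂ 2) p).symm ⁻¹'
        (chartAt (EuclideanHalfSpace 2) q).source) :=
    (contMDiffOn_extChartAt (x := q)).comp
      ((contMDiffOn_extChartAt_symm p).mono inter_subset_left) fun _ h => h.2
  exact planeEquiv.symm.contDiff.comp_contDiffOn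
    ((contMDiffOn_iff_contDiffOn.1 h1).comp planeEquiv.contDiff.contDiffOn fun _ h => h)

/-- The frame `J` is the differential of the parametrization. It does not depend on `a`, so the
conditions relating `f` and `N` on tangent spaces can be read in one and the same chart. -/
theorem exists_chartFrame (p : M) {u : ℝ × ℝ} (hu : u ∈ chartDomain p) :
    ∃ J : (ℝ × ℝ) →ₗ[ℝ] TangentSpace (𝓡∂ 2) (chartPar p u), Function.Bijective J ∧
      ∀ a : M → Sol, ContMDiff (𝓡∂ 2) 𝓘(ℝ, Sol) ∞ a → ∀ v,
        fderivWithin ℝ (a ∘ chartPar p) (chartDomain p) u v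
          = differential (𝓡∂ 2) a (chartPar p u) (J v) := by
  have hinv := isInvertible_mfderivWithin_extChartAt_symm (I := 𝓡∂ 2) (x := p) hu
  set J0 : EuclideanSpace ℝ (Fin 2) →L[ℝ] TangentSpace (𝓡∂ 2) (chartPar p u) :=
    mfderivWithin 𝓘(ℝ, EuclideanSpace ℝ (Fin 2)) (𝓡∂ 2) (extChartAt (𝓡∂ 2) p).symm
      (range (𝓡∂ 2)) (planeEquiv u) with hJ0
  refine ⟨J0.toLinearMap ∘ₗ planeEquiv.toLinearMap, ?_, fun a ha v => ?_⟩
  · exact hinv.bijective.comp planeEquiv.bijective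
  · have h1 := (mdifferentiableWithinAt_extChartAt_symm (I := 𝓡∂ 2) (x := p) hu).hasMFDerivWithinAt
    have h2 := ((ha.mdifferentiable (by simp)) (chartPar p u)).hasMFDerivAt
    have h3 := (hasMFDerivWithinAt_iff_hasFDerivWithinAt.1
      (HasMFDerivAt.comp_hasMFDerivWithinAt (planeEquiv u) h2 h1))
    have h4 := h3.comp (s := chartDomain p) u planeEquiv.hasFDerivAt.hasFDerivWithinAt
      fun w hw => extChartAt_target_subset_range p hw
    have h5 := h4.fderivWithin ((isHalfOpen_chartDomain p).uniqueDiffOn u hu)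
    exact congrArg (fun L => L v) h5

theorem mem_boundary_iff {p q : M} (hq : q ∈ (chartAt (EuclideanHalfSpace 2) p).source) :
    q ∈ (𝓡∂ 2).boundary M ↔ (chartCoord p q).1 = 0 := by
  have hint : (𝓡∂ 2).IsInteriorPoint q ↔ 0 < (chartCoord p q).1 := by
    rw [ModelWithCorners.isInteriorPoint_iff_of_mem_atlas (n := ∞) (by simp)
      (chart_mem_atlas _ p) hq]
    have hrange : 0 < (chartCoord p q).1 ↔ extChartAt (𝓡∂ 2) p q ∈ interior (range (𝓡∂ 2)) := by
      rw [interior_range_modelWithCornersEuclideanHalfSpace]; rfl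
    rw [hrange]
    exact ⟨fun h => OpenPartialHomeomorph.interior_extend_target_subset_interior_range _ h,
      fun h => OpenPartialHomeomorph.mem_interior_extend_target _
        ((chartAt (EuclideanHalfSpace 2) p).map_source hq) h⟩
  have h0 : 0 ≤ (chartCoord p q).1 := (isHalfOpen_chartDomain p).subset (chartCoord_mem hq)
  change (𝓡∂ 2).IsBoundaryPoint q ↔ _
  rw [ModelWithCorners.isBoundaryPoint_iff_not_isInteriorPoint, hint, not_lt]
  exact ⟨fun h => le_antisymm h h0, fun h => h.le⟩

end Charts

/-! ### Orientation by the normal and change of chart -/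

/-- The sign of a real number, as a real number. -/
noncomputable def sgn (x : ℝ) : ℝ := ((SignType.sign x : SignType) : ℝ)

theorem sgn_mul (x y : ℝ) : sgn (x * y) = sgn x * sgn y := by
  simp [sgn, sign_mul]

theorem sgn_mul_self (x : ℝ) : sgn x * x = |x| := sign_mul_self x

theorem sgn_sq {x : ℝ} (hx : x ≠ 0) : sgn x * sgn x = 1 := by
  rcases hx.lt_or_gt with h | h
  · simp [sgn, sign_neg h]
  · simp [sgn, sign_pos h]

theorem sgn_of_pos {x : ℝ} (hx : 0 < x) : sgn x = 1 := by simp [sgn, sign_pos hx]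

theorem eventually_sgn_eq {X : Type*} {l : Filter X} {f : X → ℝ} {y : ℝ}
    (hf : Tendsto f l (𝓝 y)) (hy : y ≠ 0) : ∀ᶠ v in l, sgn (f v) = sgn y := by
  rcases hy.lt_or_gt with h | h
  · filter_upwards [hf.eventually (gt_mem_nhds h)] with v hv
    simp [sgn, sign_neg h, sign_neg hv]
  · filter_upwards [hf.eventually (lt_mem_nhds h)] with v hv
    simp [sgn, sign_pos h, sign_pos hv]

/-- The determinant of three vectors. -/
def det3 (a b c : Sol) : ℝ :=
  a 0 * (b 1 * c 2 - b 2 * c 1) - a 1 * (b 0 * c 2 - b 2 * c 0) + a 2 * (b 0 * c 1 - b 1 * c 0)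

theorem apply_eq_fst_snd {F : Type*} [NormedAddCommGroup F] [NormedSpace ℝ F]
    (L : (ℝ × ℝ) →L[ℝ] F) (v : ℝ × ℝ) : L v = v.1 • L (1, 0) + v.2 • L (0, 1) := by
  rw [← map_smul, ← map_smul, ← map_add]
  simp

theorem det_eq (L : (ℝ × ℝ) →L[ℝ] (ℝ × ℝ)) :
    L.det = (L (1, 0)).1 * (L (0, 1)).2 - (L (1, 0)).2 * (L (0, 1)).1 := by
  rw [ContinuousLinearMap.det, ← LinearMap.det_toMatrix (Module.Basis.finTwoProd ℝ),
    Matrix.det_fin_two]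
  simp [LinearMap.toMatrix_apply]
  ring

theorem integrableOn_of_notMem {D K : Set (ℝ × ℝ)} (hD : MeasurableSet D) (hK : IsCompact K)
    (hKD : K ⊆ D) {φ : ℝ × ℝ → ℝ} (hφ : ContinuousOn φ D) (h0 : ∀ u ∈ D, u ∉ K → φ u = 0) :
    IntegrableOn φ D :=
  ((hφ.mono hKD).integrableOn_compact hK).of_forall_sdiff_eq_zero hD fun u hu => h0 u hu.1 hu.2

section Charts

variable {M : Type*} [TopologicalSpace M] [ChartedSpace (EuclideanHalfSpace 2) M]

/-- The part of the domain of the parametrization around `p` seen by the chart around `q`. -/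
def overlap (p q : M) : Set (ℝ × ℝ) :=
  chartDomain p ∩ chartPar p ⁻¹' (chartAt (EuclideanHalfSpace 2) q).source

theorem isHalfOpen_overlap (p q : M) : IsHalfOpen (overlap p q) := by
  obtain ⟨O, hO, hD⟩ := isHalfOpen_chartDomain p
  obtain ⟨O', hO', h⟩ := (continuousOn_iff'.1 (continuousOn_chartPar p)) _
    (chartAt (EuclideanHalfSpace 2) q).open_source
  refine ⟨O' ∩ O, hO'.inter hO, ?_⟩
  rw [overlap, inter_comm, h, hD, inter_assoc]

theorem transition_mem {p q : M} {u : ℝ × ℝ} (hu : u ∈ overlap p q) :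
    chartCoord q (chartPar p u) ∈ overlap q p := by
  refine ⟨chartCoord_mem hu.2, ?_⟩
  rw [mem_preimage, chartPar_chartCoord hu.2]
  exact chartPar_mem p hu.1

theorem transition_image (p q : M) :
    (chartCoord q ∘ chartPar p) '' overlap p q = overlap q p := by
  refine subset_antisymm (image_subset_iff.2 fun u hu => transition_mem hu) fun u hu => ?_
  refine ⟨chartCoord p (chartPar q u), transition_mem hu, ?_⟩
  simp only [Function.comp_apply]
  rw [chartPar_chartCoord hu.2, chartCoord_chartPar hu.1]

theorem transition_injOn (p q : M) : InjOn (chartCoord q ∘ chartPar p) (overlap p q) := by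
  intro u hu v hv h
  have h' := congrArg (chartPar q) h
  simp only [Function.comp_apply] at h'
  rw [chartPar_chartCoord hu.2, chartPar_chartCoord hv.2] at h'
  rw [← chartCoord_chartPar hu.1, h', chartCoord_chartPar hv.1]

/-- The differential of the change of coordinates. -/
noncomputable def transitionDeriv (p q : M) (u : ℝ × ℝ) : (ℝ × ℝ) →L[ℝ] (ℝ × ℝ) :=
  fderivWithin ℝ (chartCoord q ∘ chartPar p) (overlap p q) u

/-- The orientation of the parametrization around `p` given by a field `N` along `f`. -/
noncomputable def orient (f N : M → Sol) (p : M) (u : ℝ × ℝ) : ℝ :=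
  det3 (N (chartPar p u)) (fderivWithin ℝ (f ∘ chartPar p) (chartDomain p) u (1, 0))
    (fderivWithin ℝ (f ∘ chartPar p) (chartDomain p) u (0, 1))

theorem wedge_comp_eq_zero {p : M} {a : M → ℝ} {h : ℝ × ℝ → ℝ} {u : ℝ × ℝ}
    (hu : u ∈ chartDomain p) (ha : chartPar p u ∉ tsupport a) :
    wedge (chartDomain p) (a ∘ chartPar p) h u = 0 := by
  have : a ∘ chartPar p =ᶠ[𝓝[chartDomain p] u] fun _ => 0 := by
    filter_upwards [(continuousOn_chartPar p u hu).preimage_mem_nhdsWithin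
      ((isClosed_tsupport a).isOpen_compl.mem_nhds ha)] with v hv
    exact image_eq_zero_of_notMem_tsupport (f := a) hv
  have h1 : fderivWithin ℝ (a ∘ chartPar p) (chartDomain p) u = 0 := by
    rw [this.fderivWithin_eq (image_eq_zero_of_notMem_tsupport (f := a) ha)]
    simp
  simp [wedge, h1]

variable [IsManifold (𝓡∂ 2) ∞ M]

theorem hasFDerivWithinAt_transition {p q : M} {u : ℝ × ℝ} (hu : u ∈ overlap p q) :
    HasFDerivWithinAt (chartCoord q ∘ chartPar p) (transitionDeriv p q u) (overlap p q) u :=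
  ((contDiffOn_chartTransition p q).differentiableOn (by simp) u hu).hasFDerivWithinAt

theorem fderivWithin_transition {p q : M} {u : ℝ × ℝ} (hu : u ∈ overlap p q) {F : Type*}
    [NormedAddCommGroup F] [NormedSpace ℝ F] {a : M → F} (ha : ContMDiff (𝓡∂ 2) 𝓘(ℝ, F) ∞ a)
    (v : ℝ × ℝ) :
    fderivWithin ℝ (a ∘ chartPar p) (chartDomain p) u v =
      fderivWithin ℝ (a ∘ chartPar q) (chartDomain q) (chartCoord q (chartPar p u))
        (transitionDeriv p q u v) := by
  have h1 := (((contDiffOn_comp_chartPar p ha).differentiableOn (by simp)) u hu.1).hasFDerivWithinAt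
  have h2 := (((contDiffOn_comp_chartPar q ha).differentiableOn (by simp)) _
    (transition_mem hu).1).hasFDerivWithinAt
  have h3 := h2.comp u (hasFDerivWithinAt_transition hu) fun v hv => (transition_mem hv).1
  have h4 : HasFDerivWithinAt (a ∘ chartPar p) _ (overlap p q) u :=
    h3.congr (fun v hv => by simp [chartPar_chartCoord hv.2]) (by simp [chartPar_chartCoord hu.2])
  exact congrArg (fun L => L v)
    ((isHalfOpen_overlap p q).uniqueDiffOn.eq hu (h1.mono inter_subset_left) h4)

theorem wedge_transition {p q : M} {u : ℝ × ℝ} (hu : u ∈ overlap p q) {a h : M → ℝ}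
    (ha : ContMDiff (𝓡∂ 2) 𝓘(ℝ, ℝ) ∞ a) (hh : ContMDiff (𝓡∂ 2) 𝓘(ℝ, ℝ) ∞ h) :
    wedge (chartDomain p) (a ∘ chartPar p) (h ∘ chartPar p) u = (transitionDeriv p q u).det *
      wedge (chartDomain q) (a ∘ chartPar q) (h ∘ chartPar q) (chartCoord q (chartPar p u)) := by
  rw [wedge, wedge, det_eq]
  simp only [fderivWithin_transition hu ha, fderivWithin_transition hu hh]
  rw [apply_eq_fst_snd (fderivWithin ℝ (a ∘ chartPar q) _ _) (transitionDeriv p q u (1, 0)),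
    apply_eq_fst_snd (fderivWithin ℝ (a ∘ chartPar q) _ _) (transitionDeriv p q u (0, 1)),
    apply_eq_fst_snd (fderivWithin ℝ (h ∘ chartPar q) _ _) (transitionDeriv p q u (1, 0)),
    apply_eq_fst_snd (fderivWithin ℝ (h ∘ chartPar q) _ _) (transitionDeriv p q u (0, 1))]
  simp only [smul_eq_mul]
  ring

theorem orient_transition {f N : M → Sol} (hf : ContMDiff (𝓡∂ 2) 𝓘(ℝ, Sol) ∞ f)
    {p q : M} {u : ℝ × ℝ} (hu : u ∈ overlap p q) :
    orient f N p u = (transitionDeriv p q u).det * orient f N q (chartCoord q (chartPar p u)) := by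
  rw [orient, orient, det_eq, fderivWithin_transition hu hf, fderivWithin_transition hu hf,
    chartPar_chartCoord hu.2,
    apply_eq_fst_snd _ (transitionDeriv p q u (1, 0)),
    apply_eq_fst_snd _ (transitionDeriv p q u (0, 1))]
  simp only [det3, Pi.add_apply, Pi.smul_apply, smul_eq_mul]
  ring

/-- The change of variables produces `|det|` while two-forms transform with `det`. The missing sign
is supplied by `orient`, which transforms with the same determinant. -/
theorem setIntegral_transition {f N : M → Sol} (hf : ContMDiff (𝓡∂ 2) 𝓘(ℝ, Sol) ∞ f)
    (p q : M) {W W' : ℝ × ℝ → ℝ}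
    (hW : ∀ u ∈ overlap p q, W u = (transitionDeriv p q u).det * W' (chartCoord q (chartPar p u))) :
    ∫ u in overlap p q, sgn (orient f N p u) * W u =
      ∫ u in overlap q p, sgn (orient f N q u) * W' u := by
  rw [← transition_image p q, integral_image_eq_integral_abs_det_fderiv_smul volume
    (isHalfOpen_overlap p q).measurableSet (fun u hu => hasFDerivWithinAt_transition hu)
    (transition_injOn p q)]
  refine setIntegral_congr_fun (isHalfOpen_overlap p q).measurableSet fun u hu => ?_
  simp only [Function.comp_apply, smul_eq_mul]
  rw [orient_transition hf hu, hW u hu, sgn_mul, ← sgn_mul_self]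
  ring

theorem continuousOn_orient {f N : M → Sol} (hf : ContMDiff (𝓡∂ 2) 𝓘(ℝ, Sol) ∞ f)
    (hN : ContMDiff (𝓡∂ 2) 𝓘(ℝ, Sol) ∞ N) (p : M) :
    ContinuousOn (orient f N p) (chartDomain p) := by
  have h1 := (contDiffOn_comp_chartPar p hf).continuousOn_fderivWithin
    (isHalfOpen_chartDomain p).uniqueDiffOn (by simp)
  have h2 := (contDiffOn_comp_chartPar p hN).continuousOn
  have h3 : ∀ v, ContinuousOn (fun u => fderivWithin ℝ (f ∘ chartPar p) (chartDomain p) u v)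
    (chartDomain p) := fun v => h1.clm_apply continuousOn_const
  have h4 : ∀ v i, ContinuousOn (fun u => fderivWithin ℝ (f ∘ chartPar p) (chartDomain p) u v i)
    (chartDomain p) := fun v i => (continuous_apply i).comp_continuousOn (h3 v)
  have h5 : ∀ i, ContinuousOn (fun u => N (chartPar p u) i) (chartDomain p) :=
    fun i => (continuous_apply i).comp_continuousOn h2
  have h6 := h4 (1, 0)
  have h7 := h4 (0, 1)
  unfold orient det3
  exact (((h5 0).mul (((h6 1).mul (h7 2)).sub ((h6 2).mul (h7 1)))).sub
    ((h5 1).mul (((h6 0).mul (h7 2)).sub ((h6 2).mul (h7 0))))).add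
    ((h5 2).mul (((h6 0).mul (h7 1)).sub ((h6 1).mul (h7 0))))

theorem eventually_sgn_orient {f N : M → Sol} (hf : ContMDiff (𝓡∂ 2) 𝓘(ℝ, Sol) ∞ f)
    (hN : ContMDiff (𝓡∂ 2) 𝓘(ℝ, Sol) ∞ N) (hfN : ∀ p : M, ∀ u ∈ chartDomain p, orient f N p u ≠ 0)
    {p : M} {u : ℝ × ℝ} (hu : u ∈ chartDomain p) :
    ∀ᶠ v in 𝓝[chartDomain p] u, sgn (orient f N p v) = sgn (orient f N p u) :=
  eventually_sgn_eq (continuousOn_orient hf hN p u hu) (hfN p u hu)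

/-- A chart domain may be disconnected, so the sign is only locally constant; as a smooth factor it
can be absorbed into the coefficient `g` in Green's formula. -/
theorem contDiffOn_sgn_orient {f N : M → Sol} (hf : ContMDiff (𝓡∂ 2) 𝓘(ℝ, Sol) ∞ f)
    (hN : ContMDiff (𝓡∂ 2) 𝓘(ℝ, Sol) ∞ N) (hfN : ∀ p : M, ∀ u ∈ chartDomain p, orient f N p u ≠ 0)
    (p : M) :
    ContDiffOn ℝ ∞ (fun u => sgn (orient f N p u)) (chartDomain p) := fun _ hu =>
  contDiffWithinAt_const.congr_of_eventuallyEq (eventually_sgn_orient hf hN hfN hu) rfl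

end Charts

/-! ### Integration over the surface with a partition of unity -/

section Green

variable {M : Type*} [TopologicalSpace M] [ChartedSpace (EuclideanHalfSpace 2) M]

theorem chartCoord_image_subset {p : M} {a : M → ℝ}
    (ha : tsupport a ⊆ (chartAt (EuclideanHalfSpace 2) p).source) :
    chartCoord p '' tsupport a ⊆ chartDomain p := by
  rintro _ ⟨q, hq, rfl⟩
  exact chartCoord_mem (ha hq)

theorem notMem_tsupport_of_notMem_image {p : M} {a : M → ℝ} {u : ℝ × ℝ} (hu : u ∈ chartDomain p)
    (h : u ∉ chartCoord p '' tsupport a) : chartPar p u ∉ tsupport a :=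
  fun hq => h ⟨_, hq, chartCoord_chartPar hu⟩

variable [CompactSpace M]

theorem isCompact_chartCoord_image {p : M} {a : M → ℝ}
    (ha : tsupport a ⊆ (chartAt (EuclideanHalfSpace 2) p).source) :
    IsCompact (chartCoord p '' tsupport a) :=
  (isClosed_tsupport a).isCompact.image_of_continuousOn ((continuousOn_chartCoord p).mono ha)

variable [IsManifold (𝓡∂ 2) ∞ M]

theorem exists_chartPartition [T2Space M] : ∃ (t : Finset M) (φ : t → M → ℝ),
    (∀ i, ContMDiff (𝓡∂ 2) 𝓘(ℝ, ℝ) ∞ (φ i)) ∧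
    (∀ i, tsupport (φ i) ⊆ (chartAt (EuclideanHalfSpace 2) (i : M)).source) ∧
    ∀ q, ∑ i, φ i q = 1 := by
  obtain ⟨t, -, ht⟩ := (isCompact_univ (X := M)).elim_nhds_subcover
    (fun p => (chartAt (EuclideanHalfSpace 2) p).source)
    fun p _ => (chartAt (EuclideanHalfSpace 2) p).open_source.mem_nhds (mem_chart_source _ p)
  obtain ⟨φ, hφ⟩ := SmoothPartitionOfUnity.exists_isSubordinate (𝓡∂ 2) isClosed_univ
    (fun i : t => (chartAt (EuclideanHalfSpace 2) (i : M)).source)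
    (fun i => (chartAt (EuclideanHalfSpace 2) (i : M)).open_source)
    (fun q hq => by simpa using ht hq)
  refine ⟨t, fun i => φ i, fun i => (φ i).contMDiff, hφ, fun q => ?_⟩
  rw [← finsum_eq_sum_of_fintype]
  exact φ.sum_eq_one (mem_univ q)

variable {f N : M → Sol} (hf : ContMDiff (𝓡∂ 2) 𝓘(ℝ, Sol) ∞ f)
  (hN : ContMDiff (𝓡∂ 2) 𝓘(ℝ, Sol) ∞ N) (hfN : ∀ p : M, ∀ u ∈ chartDomain p, orient f N p u ≠ 0)

include hf hN hfN

/-- Green's formula in the parametrization around `p`. -/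
theorem integral_wedge_chart {p : M} {b h : M → ℝ} (hb : ContMDiff (𝓡∂ 2) 𝓘(ℝ, ℝ) ∞ b)
    (hh : ContMDiff (𝓡∂ 2) 𝓘(ℝ, ℝ) ∞ h)
    (hbp : tsupport b ⊆ (chartAt (EuclideanHalfSpace 2) p).source) :
    ∫ u in chartDomain p, sgn (orient f N p u) *
        wedge (chartDomain p) (b ∘ chartPar p) (h ∘ chartPar p) u =
      -∫ t in {t : ℝ | ((0 : ℝ), t) ∈ chartDomain p}, sgn (orient f N p (0, t)) *
        b (chartPar p (0, t)) *
          fderivWithin ℝ (h ∘ chartPar p) (chartDomain p) (0, t) (0, 1) := by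
  have hD := isHalfOpen_chartDomain p
  have hbc := contDiffOn_comp_chartPar p hb
  have hε := contDiffOn_sgn_orient hf hN hfN p
  rw [← integral_wedge hD (isCompact_chartCoord_image hbp) (chartCoord_image_subset hbp)
    (g := fun u => sgn (orient f N p u) * b (chartPar p u)) (hε.mul hbc)
    (contDiffOn_comp_chartPar p hh) fun u hu huK => ?_]
  · refine setIntegral_congr_fun hD.measurableSet fun u hu => ?_
    have h1 : (fun u => sgn (orient f N p u) * b (chartPar p u)) =ᶠ[𝓝[chartDomain p] u]
        fun v => sgn (orient f N p u) * (b ∘ chartPar p) v :=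
      (eventually_sgn_orient hf hN hfN hu).mono fun v hv => by simp [hv]
    have h2 : fderivWithin ℝ (fun u => sgn (orient f N p u) * b (chartPar p u)) (chartDomain p) u
        = sgn (orient f N p u) • fderivWithin ℝ (b ∘ chartPar p) (chartDomain p) u := by
      rw [h1.fderivWithin_eq rfl,
        fderivWithin_const_mul (hD.uniqueDiffOn u hu) (hbc.differentiableOn (by simp) u hu)]
    simp only [wedge, h2, smul_apply, smul_eq_mul]
    ring
  · rw [image_eq_zero_of_notMem_tsupport (notMem_tsupport_of_notMem_image hu huK), mul_zero]

/-- The integral of a two-form over the surface, computed with a partition of unity. -/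
theorem sum_integral_wedge {ι : Type*} [Fintype ι] {ctr : ι → M} {φ : ι → M → ℝ}
    (hφ : ∀ i, ContMDiff (𝓡∂ 2) 𝓘(ℝ, ℝ) ∞ (φ i))
    (hsupp : ∀ i, tsupport (φ i) ⊆ (chartAt (EuclideanHalfSpace 2) (ctr i)).source)
    (hsum : ∀ q, ∑ i, φ i q = 1) {g h : M → ℝ} (hg : ContMDiff (𝓡∂ 2) 𝓘(ℝ, ℝ) ∞ g)
    (hh : ContMDiff (𝓡∂ 2) 𝓘(ℝ, ℝ) ∞ h) :
    ∑ i, ∫ u in chartDomain (ctr i), sgn (orient f N (ctr i) u) *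
        wedge (chartDomain (ctr i)) ((φ i * g) ∘ chartPar (ctr i)) (h ∘ chartPar (ctr i)) u =
      ∑ j, ∫ u in chartDomain (ctr j), sgn (orient f N (ctr j) u) * (φ j (chartPar (ctr j) u) *
        wedge (chartDomain (ctr j)) (g ∘ chartPar (ctr j)) (h ∘ chartPar (ctr j)) u) := by
  have hφg : ∀ i, ContMDiff (𝓡∂ 2) 𝓘(ℝ, ℝ) ∞ (φ i * g) := fun i => (hφ i).mul hg
  have hts : ∀ i, tsupport (φ i * g) ⊆ tsupport (φ i) := fun i => tsupport_mul_subset_left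
  have cint : ∀ i j p, ContinuousOn (fun u => sgn (orient f N p u) * (φ j (chartPar p u) *
      wedge (chartDomain p) ((φ i * g) ∘ chartPar p) (h ∘ chartPar p) u)) (chartDomain p) :=
    fun i j p => (contDiffOn_sgn_orient hf hN hfN p).continuousOn.mul
      ((contDiffOn_comp_chartPar p (hφ j)).continuousOn.mul
        (continuousOn_wedge (isHalfOpen_chartDomain p) (contDiffOn_comp_chartPar p (hφg i))
          (contDiffOn_comp_chartPar p hh)))
  have hint1 : ∀ i j, IntegrableOn (fun u => sgn (orient f N (ctr i) u) *
      (φ j (chartPar (ctr i) u) * wedge (chartDomain (ctr i)) ((φ i * g) ∘ chartPar (ctr i))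
        (h ∘ chartPar (ctr i)) u)) (chartDomain (ctr i)) := fun i j =>
    integrableOn_of_notMem (isHalfOpen_chartDomain _).measurableSet
      (isCompact_chartCoord_image (hsupp i)) (chartCoord_image_subset (hsupp i)) (cint i j _)
      fun u hu huK => by
        rw [wedge_comp_eq_zero hu fun hq => notMem_tsupport_of_notMem_image hu huK (hts i hq)]
        ring
  have hint2 : ∀ i j, IntegrableOn (fun u => sgn (orient f N (ctr j) u) *
      (φ j (chartPar (ctr j) u) * wedge (chartDomain (ctr j)) ((φ i * g) ∘ chartPar (ctr j))
        (h ∘ chartPar (ctr j)) u)) (chartDomain (ctr j)) := fun i j =>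
    integrableOn_of_notMem (isHalfOpen_chartDomain _).measurableSet
      (isCompact_chartCoord_image (hsupp j)) (chartCoord_image_subset (hsupp j)) (cint i j _)
      fun u hu huK => by
        rw [image_eq_zero_of_notMem_tsupport (notMem_tsupport_of_notMem_image hu huK)]
        ring
  -- The integrand carries both `φ i` and `φ j`, so it vanishes off the overlap of the two charts
  -- and can be moved from one to the other. Then `∑ d(φ i g) = dg` finishes the computation in
  -- chart `j`.
  have hswap : ∀ i j, ∫ u in chartDomain (ctr i), sgn (orient f N (ctr i) u) *
        (φ j (chartPar (ctr i) u) * wedge (chartDomain (ctr i)) ((φ i * g) ∘ chartPar (ctr i))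
          (h ∘ chartPar (ctr i)) u) =
      ∫ u in chartDomain (ctr j), sgn (orient f N (ctr j) u) *
        (φ j (chartPar (ctr j) u) * wedge (chartDomain (ctr j)) ((φ i * g) ∘ chartPar (ctr j))
          (h ∘ chartPar (ctr j)) u) := by
    intro i j
    have h1 := setIntegral_transition (N := N) hf (ctr i) (ctr j)
      (W := fun u => φ j (chartPar (ctr i) u) * wedge (chartDomain (ctr i))
        ((φ i * g) ∘ chartPar (ctr i)) (h ∘ chartPar (ctr i)) u)
      (W' := fun u => φ j (chartPar (ctr j) u) * wedge (chartDomain (ctr j))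
        ((φ i * g) ∘ chartPar (ctr j)) (h ∘ chartPar (ctr j)) u) fun u hu => by
        rw [wedge_transition hu (hφg i) hh, chartPar_chartCoord hu.2]
        ring
    rw [setIntegral_eq_of_subset_of_forall_sdiff_eq_zero
        (isHalfOpen_chartDomain (ctr i)).measurableSet inter_subset_left,
      setIntegral_eq_of_subset_of_forall_sdiff_eq_zero
        (isHalfOpen_chartDomain (ctr j)).measurableSet inter_subset_left]
    · exact h1
    · intro u hu
      rw [wedge_comp_eq_zero hu.1 fun hq => hu.2 ⟨hu.1, hsupp i (hts i hq)⟩]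
      ring
    · intro u hu
      have : chartPar (ctr i) u ∉ tsupport (φ j) := fun hq => hu.2 ⟨hu.1, hsupp j hq⟩
      rw [image_eq_zero_of_notMem_tsupport this]
      ring
  have hL : ∀ i, ∫ u in chartDomain (ctr i), sgn (orient f N (ctr i) u) *
        wedge (chartDomain (ctr i)) ((φ i * g) ∘ chartPar (ctr i)) (h ∘ chartPar (ctr i)) u =
      ∑ j, ∫ u in chartDomain (ctr i), sgn (orient f N (ctr i) u) *
        (φ j (chartPar (ctr i) u) * wedge (chartDomain (ctr i)) ((φ i * g) ∘ chartPar (ctr i))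
          (h ∘ chartPar (ctr i)) u) := fun i => by
    rw [← integral_finsetSum _ fun j _ => hint1 i j]
    refine integral_congr_ae (ae_of_all _ fun u => ?_)
    simp only
    rw [← Finset.mul_sum, ← Finset.sum_mul, hsum, one_mul]
  rw [Finset.sum_congr rfl fun i _ => hL i, Finset.sum_comm]
  refine Finset.sum_congr rfl fun j _ => ?_
  rw [Finset.sum_congr rfl fun i _ => hswap i j, ← integral_finsetSum _ fun i _ => hint2 i j]
  refine setIntegral_congr_fun (isHalfOpen_chartDomain (ctr j)).measurableSet fun u hu => ?_
  rw [← Finset.mul_sum, ← Finset.mul_sum]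
  congr 2
  have hd : ∀ i, DifferentiableWithinAt ℝ ((φ i * g) ∘ chartPar (ctr j)) (chartDomain (ctr j)) u :=
    fun i => (contDiffOn_comp_chartPar (ctr j) (hφg i)).differentiableOn (by simp) u hu
  have hgsum : g ∘ chartPar (ctr j) = fun u => ∑ i, ((φ i * g) ∘ chartPar (ctr j)) u := by
    funext u
    simp only [Function.comp_apply, Pi.mul_apply, ← Finset.sum_mul, hsum, one_mul]
  have hfd : fderivWithin ℝ (g ∘ chartPar (ctr j)) (chartDomain (ctr j)) u =
      ∑ i, fderivWithin ℝ ((φ i * g) ∘ chartPar (ctr j)) (chartDomain (ctr j)) u := by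
    rw [hgsum, fderivWithin_fun_sum ((isHalfOpen_chartDomain (ctr j)).uniqueDiffOn u hu)
      fun i _ => hd i]
  simp only [wedge, hfd, sum_apply, Finset.sum_mul, Finset.sum_sub_distrib]

end Green

/-! ### The boundary curve -/

/-- By the inverse function theorem `τ` is locally `F⁻¹ ∘ (F ∘ τ)`. This upgrades the lift of the
boundary curve, known only to be continuous, to a differentiable one. -/
theorem hasDerivAt_of_comp {F τ : ℝ → ℝ} {c d s : ℝ} (hF : HasStrictDerivAt F c (τ s)) (hc : c ≠ 0)
    (hτ : ContinuousAt τ s) (h : HasDerivAt (fun x => F (τ x)) d s) :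
    HasDerivAt τ (c⁻¹ * d) s := by
  have h1 : HasDerivAt (hF.localInverse F c (τ s) hc) c⁻¹ (F (τ s)) :=
    (hF.to_localInverse hc).hasDerivAt
  have h2 := h1.comp s h
  refine h2.congr_of_eventuallyEq ?_
  exact (hτ.eventually (HasStrictFDerivAt.eventually_left_inverse (hF.hasStrictFDerivAt_equiv hc))).mono
    fun x hx => hx.symm

/-- A curve `γ` parametrizing the boundary of the immersed surface `f : M → Sol`. -/
structure IsBoundaryLift {M : Type*} [TopologicalSpace M] [ChartedSpace (EuclideanHalfSpace 2) M]
    (f : M → Sol) (α : ℝ → Sol) (T : ℝ) (γ : ℝ → M) : Prop where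
  continuous : Continuous γ
  mem_boundary : ∀ s, γ s ∈ (𝓡∂ 2).boundary M
  map_eq : ∀ s, f (γ s) = α s
  surj : ∀ q ∈ (𝓡∂ 2).boundary M, ∃ s ∈ Ico 0 T, γ s = q
  injOn : InjOn γ (Ico 0 T)

section Boundary

variable {M : Type*} [TopologicalSpace M] [ChartedSpace (EuclideanHalfSpace 2) M]

/-- The lift is `α` followed by the inverse of `f` on the boundary. That inverse is continuous
because a continuous injection of a compact space into a Hausdorff space is a closed embedding. -/
theorem IsBoundaryLift.exists_of_bijOn [CompactSpace M] [T2Space M] [IsManifold (𝓡∂ 2) ∞ M]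
    {f : M → Sol} (hf : Continuous f)
    {α : ℝ → Sol} {T : ℝ} (hT : 0 < T) (hα : Continuous α) (hper : Function.Periodic α T)
    (hinj : InjOn α (Ico 0 T)) (hbij : BijOn f ((𝓡∂ 2).boundary M) (range α)) :
    ∃ γ, IsBoundaryLift f α T γ := by
  choose γ hγ hfγ using fun s => hbij.surjOn (mem_range_self (f := α) s)
  have hclosed : IsClosed ((𝓡∂ 2).boundary M) :=
    ModelWithCorners.isClosed_boundary (n := ∞) (by simp)
  refine ⟨γ, ?_, hγ, hfγ, fun q hq => ?_, fun s hs t ht h => hinj hs ht ?_⟩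
  · have : CompactSpace ((𝓡∂ 2).boundary M) := isCompact_iff_compactSpace.1 hclosed.isCompact
    have hemb : Topology.IsClosedEmbedding (((𝓡∂ 2).boundary M).domRestrict f) :=
      (hf.comp continuous_subtype_val).isClosedEmbedding hbij.injOn.injective
    have h1 : Continuous fun s => (⟨γ s, hγ s⟩ : (𝓡∂ 2).boundary M) := by
      rw [hemb.isInducing.continuous_iff]
      exact hα.congr fun s => (hfγ s).symm
    exact continuous_subtype_val.comp h1
  · obtain ⟨s, hs⟩ := hbij.mapsTo hq
    obtain ⟨t, ht, hst⟩ := hper.exists_mem_Ico₀ hT s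
    exact ⟨t, ht, hbij.injOn (hγ t) hq (by rw [hfγ, ← hst, hs])⟩
  · rw [← hfγ, ← hfγ, h]

theorem hasStrictDerivAt_slice [IsManifold (𝓡∂ 2) ∞ M] {F : Type*} [NormedAddCommGroup F] [NormedSpace ℝ F] {a : M → F}
    (ha : ContMDiff (𝓡∂ 2) 𝓘(ℝ, F) ∞ a) {p : M} {t : ℝ} (ht : ((0 : ℝ), t) ∈ chartDomain p) :
    HasStrictDerivAt (fun t => a (chartPar p (0, t)))
      (fderivWithin ℝ (a ∘ chartPar p) (chartDomain p) (0, t) (0, 1)) t := by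
  have hmaps : MapsTo (fun t : ℝ => ((0 : ℝ), t)) {t : ℝ | ((0 : ℝ), t) ∈ chartDomain p}
    (chartDomain p) := fun _ h => h
  have hnhds := (isHalfOpen_chartDomain p).isOpen_slice.mem_nhds ht
  have h1 : ContDiffAt ℝ ∞ (fun t => a (chartPar p (0, t))) t :=
    ((contDiffOn_comp_chartPar p ha).comp (contDiff_const.prodMk contDiff_id).contDiffOn
      hmaps).contDiffAt hnhds
  have h2 := (((contDiffOn_comp_chartPar p ha).differentiableOn (by simp)) _ ht).hasFDerivWithinAt
  have h3 : HasDerivWithinAt (fun t : ℝ => ((0 : ℝ), t)) (0, 1)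
    {t : ℝ | ((0 : ℝ), t) ∈ chartDomain p} t :=
    ((hasDerivAt_const t (0 : ℝ)).prodMk (hasDerivAt_id t)).hasDerivWithinAt
  have h4 := (h2.comp_hasDerivWithinAt t h3 hmaps).hasDerivAt hnhds
  have h5 := h1.hasStrictDerivAt (by simp)
  have h6 : deriv (fun t => a (chartPar p (0, t))) t = _ := h4.deriv
  rwa [h6] at h5

namespace IsBoundaryLift

variable {f : M → Sol} {α : ℝ → Sol} {T : ℝ} {γ : ℝ → M} (hγ : IsBoundaryLift f α T γ)

include hγ

theorem isOpen_preimage (p : M) : IsOpen (γ ⁻¹' (chartAt (EuclideanHalfSpace 2) p).source) :=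
  (chartAt (EuclideanHalfSpace 2) p).open_source.preimage hγ.continuous

theorem continuousOn_coord (p : M) : ContinuousOn (fun s => chartCoord p (γ s))
    (γ ⁻¹' (chartAt (EuclideanHalfSpace 2) p).source) :=
  (continuousOn_chartCoord p).comp hγ.continuous.continuousOn fun _ h => h

variable [IsManifold (𝓡∂ 2) ∞ M]

theorem chartCoord_eq {p : M} {s : ℝ} (hs : γ s ∈ (chartAt (EuclideanHalfSpace 2) p).source) :
    chartCoord p (γ s) = (0, (chartCoord p (γ s)).2) :=
  Prod.ext ((mem_boundary_iff hs).1 (hγ.mem_boundary s)) rfl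

theorem chartPar_eq {p : M} {s : ℝ} (hs : γ s ∈ (chartAt (EuclideanHalfSpace 2) p).source) :
    chartPar p (0, (chartCoord p (γ s)).2) = γ s := by
  rw [← hγ.chartCoord_eq hs, chartPar_chartCoord hs]

theorem mem_chartDomain {p : M} {s : ℝ} (hs : γ s ∈ (chartAt (EuclideanHalfSpace 2) p).source) :
    (0, (chartCoord p (γ s)).2) ∈ chartDomain p := by
  rw [← hγ.chartCoord_eq hs]
  exact chartCoord_mem hs

theorem image_coord (p : M) :
    (fun s => (chartCoord p (γ s)).2) ''
      (Ico 0 T ∩ γ ⁻¹' (chartAt (EuclideanHalfSpace 2) p).source) =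
      {t : ℝ | ((0 : ℝ), t) ∈ chartDomain p} := by
  refine subset_antisymm ?_ fun t ht => ?_
  · rintro _ ⟨s, hs, rfl⟩
    exact hγ.mem_chartDomain hs.2
  · have hsrc := chartPar_mem p ht
    have hb : chartPar p (0, t) ∈ (𝓡∂ 2).boundary M := by
      rw [mem_boundary_iff hsrc, chartCoord_chartPar ht]
    obtain ⟨s, hs, hsq⟩ := hγ.surj _ hb
    refine ⟨s, ⟨hs, by rw [mem_preimage, hsq]; exact hsrc⟩, ?_⟩
    simp only
    rw [hsq, chartCoord_chartPar ht]

theorem injOn_coord (p : M) : InjOn (fun s => (chartCoord p (γ s)).2)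
    (Ico 0 T ∩ γ ⁻¹' (chartAt (EuclideanHalfSpace 2) p).source) := by
  intro s hs t ht h
  refine hγ.injOn hs.1 ht.1 ?_
  rw [← hγ.chartPar_eq hs.2, ← hγ.chartPar_eq ht.2]
  simp only at h
  rw [h]

theorem exists_hasDerivAt_coord (hf : ContMDiff (𝓡∂ 2) 𝓘(ℝ, Sol) ∞ f) (hα : ContDiff ℝ ∞ α)
    {p : M} (himm : ∀ u ∈ chartDomain p,
      fderivWithin ℝ (f ∘ chartPar p) (chartDomain p) u (0, 1) ≠ 0)
    {s : ℝ} (hs : γ s ∈ (chartAt (EuclideanHalfSpace 2) p).source) :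
    ∃ τ' : ℝ, HasDerivAt (fun s => (chartCoord p (γ s)).2) τ' s := by
  have hF := hasStrictDerivAt_slice hf (hγ.mem_chartDomain hs)
  obtain ⟨k, hk⟩ := Function.ne_iff.1 (himm _ (hγ.mem_chartDomain hs))
  have hFk := hasStrictDerivAt_pi.1 hF k
  have hαk := hasDerivAt_pi.1 ((hα.differentiable (by simp)) s).hasDerivAt k
  refine ⟨_, hasDerivAt_of_comp hFk hk (continuous_snd.continuousAt.comp
    ((hγ.continuousOn_coord p).continuousAt ((hγ.isOpen_preimage p).mem_nhds hs)))
    (hαk.congr_of_eventuallyEq ?_)⟩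
  filter_upwards [(hγ.isOpen_preimage p).mem_nhds hs] with x hx
  rw [hγ.chartPar_eq hx, hγ.map_eq]

theorem hasDerivAt_comp {F : Type*} [NormedAddCommGroup F] [NormedSpace ℝ F] {a : M → F}
    (ha : ContMDiff (𝓡∂ 2) 𝓘(ℝ, F) ∞ a) {p : M} {s τ' : ℝ}
    (hs : γ s ∈ (chartAt (EuclideanHalfSpace 2) p).source)
    (hτ : HasDerivAt (fun s => (chartCoord p (γ s)).2) τ' s) :
    HasDerivAt (fun s => a (γ s)) (τ' • fderivWithin ℝ (a ∘ chartPar p) (chartDomain p)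
      (0, (chartCoord p (γ s)).2) (0, 1)) s := by
  have h1 := (hasStrictDerivAt_slice ha (hγ.mem_chartDomain hs)).hasDerivAt.scomp s hτ
  refine h1.congr_of_eventuallyEq ?_
  filter_upwards [(hγ.isOpen_preimage p).mem_nhds hs] with x hx
  simp only [Function.comp_apply]
  rw [hγ.chartPar_eq hx]

end IsBoundaryLift

end Boundary

/-! ### Stokes' theorem -/

section Stokes

variable {M : Type*} [TopologicalSpace M] [ChartedSpace (EuclideanHalfSpace 2) M]

/-- The first coordinate of the transition is nonnegative and vanishes at `u`, so `u` is a minimum,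
and the derivative in the admissible direction `(1, 0)` cannot be negative. -/
theorem fst_transitionDeriv_nonneg [IsManifold (𝓡∂ 2) ∞ M] {p q : M} {u : ℝ × ℝ}
    (hu : u ∈ overlap p q)
    (h0 : (chartCoord q (chartPar p u)).1 = 0) : 0 ≤ (transitionDeriv p q u (1, 0)).1 := by
  have hd : HasFDerivWithinAt (fun v => (chartCoord q (chartPar p v)).1)
      ((ContinuousLinearMap.fst ℝ ℝ ℝ).comp (transitionDeriv p q u)) (overlap p q) u :=
    (ContinuousLinearMap.fst ℝ ℝ ℝ).hasFDerivAt.comp_hasFDerivWithinAt u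
      (hasFDerivWithinAt_transition hu)
  have hmin : IsLocalMinOn (fun v => (chartCoord q (chartPar p v)).1) (overlap p q) u := by
    filter_upwards [self_mem_nhdsWithin] with v hv
    rw [h0]
    exact (isHalfOpen_overlap q p).subset (transition_mem hv)
  refine hmin.hasFDerivWithinAt_nonneg hd (mem_posTangentConeAt_of_frequently_mem ?_)
  obtain ⟨O, hO, hOe⟩ := isHalfOpen_overlap p q
  have huO : u ∈ O := (hOe ▸ hu).1
  have hu1 : 0 ≤ u.1 := (isHalfOpen_overlap p q).subset hu
  refine Eventually.frequently ?_
  have hcont : Tendsto (fun t : ℝ => u + t • ((1 : ℝ), (0 : ℝ))) (𝓝[>] 0) (𝓝 u) := by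
    have : Continuous fun t : ℝ => u + t • ((1 : ℝ), (0 : ℝ)) := by fun_prop
    have h := (this.tendsto 0).mono_left (nhdsWithin_le_nhds (s := Ioi 0))
    simpa using h
  filter_upwards [hcont.eventually (hO.mem_nhds huO), self_mem_nhdsWithin] with t ht ht0
  rw [hOe]
  refine ⟨ht, ?_⟩
  have : (0 : ℝ) < t := ht0
  simp only [mem_ofPred_eq, Prod.fst_add, Prod.smul_fst, smul_eq_mul, mul_one]
  linarith

/-- The determinant of the normal, the inward direction of the chart around `p` and the boundary
velocity. -/
noncomputable def coorient (f N : M → Sol) (α : ℝ → Sol) (γ : ℝ → M) (p : M) (s : ℝ) : ℝ :=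
  det3 (N (γ s))
    (fderivWithin ℝ (f ∘ chartPar p) (chartDomain p) (chartCoord p (γ s)) (1, 0)) (deriv α s)

variable [IsManifold (𝓡∂ 2) ∞ M]
  {f N : M → Sol} (hf : ContMDiff (𝓡∂ 2) 𝓘(ℝ, Sol) ∞ f)
  (hN : ContMDiff (𝓡∂ 2) 𝓘(ℝ, Sol) ∞ N) (hfN : ∀ p : M, ∀ u ∈ chartDomain p, orient f N p u ≠ 0)
  {α : ℝ → Sol} {T : ℝ} {γ : ℝ → M} (hγ : IsBoundaryLift f α T γ) (hα : ContDiff ℝ ∞ α)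
  (hα' : ∀ s, deriv α s ≠ 0)

include hf hfN hγ hα hα'

omit hγ hα hα' hf [IsManifold (𝓡∂ 2) ∞ M] in
theorem fderivWithin_ne_zero_of_orient {p : M} {u : ℝ × ℝ} (hu : u ∈ chartDomain p) :
    fderivWithin ℝ (f ∘ chartPar p) (chartDomain p) u (0, 1) ≠ 0 := fun h => by
  refine hfN p u hu ?_
  simp [orient, det3, h]

theorem exists_hasDerivAt_tangential {p : M} {s : ℝ}
    (hs : γ s ∈ (chartAt (EuclideanHalfSpace 2) p).source) :
    ∃ τ' : ℝ, τ' ≠ 0 ∧ HasDerivAt (fun s => (chartCoord p (γ s)).2) τ' s ∧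
      deriv α s = τ' • fderivWithin ℝ (f ∘ chartPar p) (chartDomain p)
        (0, (chartCoord p (γ s)).2) (0, 1) := by
  obtain ⟨τ', hτ⟩ := hγ.exists_hasDerivAt_coord hf hα
    (fun u hu => fderivWithin_ne_zero_of_orient hfN hu) hs
  have h1 := hγ.hasDerivAt_comp hf hs hτ
  rw [show (fun s => f (γ s)) = α from funext hγ.map_eq] at h1
  refine ⟨τ', ?_, hτ, h1.deriv⟩
  rintro rfl
  exact hα' s (by rw [h1.deriv, zero_smul])

omit hf hfN hα hα' in
theorem coorient_eq {p : M} {s τ' : ℝ} (hs : γ s ∈ (chartAt (EuclideanHalfSpace 2) p).source)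
    (h : deriv α s = τ' • fderivWithin ℝ (f ∘ chartPar p) (chartDomain p)
        (0, (chartCoord p (γ s)).2) (0, 1)) :
    coorient f N α γ p s = τ' * orient f N p (0, (chartCoord p (γ s)).2) := by
  rw [coorient, orient, hγ.chartPar_eq hs, ← hγ.chartCoord_eq hs, h, ← hγ.chartCoord_eq hs]
  simp only [det3, Pi.smul_apply, smul_eq_mul]
  ring

theorem coorient_ne_zero {p : M} {s : ℝ} (hs : γ s ∈ (chartAt (EuclideanHalfSpace 2) p).source) :
    coorient f N α γ p s ≠ 0 := by
  obtain ⟨τ', h0, -, h⟩ := exists_hasDerivAt_tangential hf hfN hγ hα hα' hs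
  rw [coorient_eq hγ hs h]
  exact mul_ne_zero h0 (hfN p _ (hγ.mem_chartDomain hs))

/-- The inward directions of two charts differ by a positive factor and a tangential term. The
latter is parallel to `deriv α s` and drops out of the determinant. -/
theorem sgn_coorient_eq {p q : M} {s : ℝ} (hp : γ s ∈ (chartAt (EuclideanHalfSpace 2) p).source)
    (hq : γ s ∈ (chartAt (EuclideanHalfSpace 2) q).source) :
    sgn (coorient f N α γ p s) = sgn (coorient f N α γ q s) := by
  have hu : chartCoord p (γ s) ∈ overlap p q :=
    ⟨chartCoord_mem hp, by rw [mem_preimage, chartPar_chartCoord hp]; exact hq⟩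
  have hA := fst_transitionDeriv_nonneg hu (by
    rw [chartPar_chartCoord hp, hγ.chartCoord_eq hq])
  obtain ⟨τ', -, -, h⟩ := exists_hasDerivAt_tangential hf hfN hγ hα hα' hq
  have key : coorient f N α γ p s =
      (transitionDeriv p q (chartCoord p (γ s)) (1, 0)).1 * coorient f N α γ q s := by
    rw [coorient, coorient, fderivWithin_transition hu hf, chartPar_chartCoord hp, h,
      ← hγ.chartCoord_eq hq,
      apply_eq_fst_snd _ (transitionDeriv p q (chartCoord p (γ s)) (1, 0))]
    simp only [det3, Pi.add_apply, Pi.smul_apply, smul_eq_mul]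
    ring
  have hne := coorient_ne_zero (N := N) hf hfN hγ hα hα' hp
  rw [key] at hne ⊢
  rw [sgn_mul, sgn_of_pos (lt_of_le_of_ne hA (left_ne_zero_of_mul hne).symm), one_mul]

include hN

omit hfN hα' in
theorem continuousOn_coorient (p : M) : ContinuousOn (coorient f N α γ p)
    (γ ⁻¹' (chartAt (EuclideanHalfSpace 2) p).source) := by
  have h1 : ∀ i, ContinuousOn (fun s => fderivWithin ℝ (f ∘ chartPar p) (chartDomain p)
      (chartCoord p (γ s)) (1, 0) i) (γ ⁻¹' (chartAt (EuclideanHalfSpace 2) p).source) := fun i =>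
    (continuous_apply i).comp_continuousOn
      (((((contDiffOn_comp_chartPar p hf).continuousOn_fderivWithin
        (isHalfOpen_chartDomain p).uniqueDiffOn (by simp)).comp (hγ.continuousOn_coord p)
        fun s hs => chartCoord_mem hs)).clm_apply continuousOn_const)
  have h2 : ∀ i, ContinuousOn (fun s => N (γ s) i)
      (γ ⁻¹' (chartAt (EuclideanHalfSpace 2) p).source) := fun i =>
    ((continuous_apply i).comp (hN.continuous.comp hγ.continuous)).continuousOn
  have h3 : ∀ i, ContinuousOn (fun s => deriv α s i)
      (γ ⁻¹' (chartAt (EuclideanHalfSpace 2) p).source) := fun i =>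
    ((continuous_apply i).comp (contDiff_infty_iff_deriv.1 hα).2.continuous).continuousOn
  unfold coorient det3
  exact (((h2 0).mul (((h1 1).mul (h3 2)).sub ((h1 2).mul (h3 1)))).sub
    ((h2 1).mul (((h1 0).mul (h3 2)).sub ((h1 2).mul (h3 0))))).add
    ((h2 2).mul (((h1 0).mul (h3 1)).sub ((h1 1).mul (h3 0))))

/-- The parametrization of the boundary has a well-defined sign with respect to the induced
orientation. -/
theorem exists_sgn_coorient : ∃ σ : ℝ, σ * σ = 1 ∧
    ∀ p s, γ s ∈ (chartAt (EuclideanHalfSpace 2) p).source → sgn (coorient f N α γ p s) = σ := by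
  -- The chart varies with `s`, but by `sgn_coorient_eq` it may be frozen near each point. Local
  -- constancy on the connected line then gives a single sign.
  have hloc : IsLocallyConstant fun s => sgn (coorient f N α γ (γ s) s) := by
    rw [IsLocallyConstant.iff_eventually_eq]
    intro s
    have hs := mem_chart_source (EuclideanHalfSpace 2) (γ s)
    have hnhds := (hγ.isOpen_preimage (γ s)).mem_nhds hs
    filter_upwards [hnhds, eventually_sgn_eq
      ((continuousOn_coorient hf hN hγ hα (γ s)).continuousAt hnhds)
      (coorient_ne_zero hf hfN hγ hα hα' hs)] with x hx hx'
    rw [← hx']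
    exact sgn_coorient_eq hf hfN hγ hα hα' (mem_chart_source _ (γ x)) hx
  refine ⟨sgn (coorient f N α γ (γ 0) 0),
    sgn_sq (coorient_ne_zero hf hfN hγ hα hα' (mem_chart_source _ _)), fun p s hs => ?_⟩
  rw [sgn_coorient_eq hf hfN hγ hα hα' hs (mem_chart_source _ (γ s))]
  exact hloc.apply_eq_of_isPreconnected isPreconnected_univ (mem_univ s) (mem_univ 0)

omit hN in
-- Substituting `t = τ(s)`, the second coordinate of `γ s`, brings in `|τ'|`, while `dh` along `γ`
-- brings in `τ'`. The discrepancy `sgn τ'` combines with the sign of `orient` to `σ`, which is the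
-- same in all charts.
theorem integral_slice {σ : ℝ}
    (hσ : ∀ p s, γ s ∈ (chartAt (EuclideanHalfSpace 2) p).source → sgn (coorient f N α γ p s) = σ)
    {p : M} {b h : M → ℝ} (hh : ContMDiff (𝓡∂ 2) 𝓘(ℝ, ℝ) ∞ h) {h' : ℝ → ℝ}
    (hh' : ∀ s, HasDerivAt (fun s => h (γ s)) (h' s) s) :
    ∫ t in {t : ℝ | ((0 : ℝ), t) ∈ chartDomain p}, sgn (orient f N p (0, t)) *
        b (chartPar p (0, t)) * fderivWithin ℝ (h ∘ chartPar p) (chartDomain p) (0, t) (0, 1) =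
      ∫ s in Ico 0 T ∩ γ ⁻¹' (chartAt (EuclideanHalfSpace 2) p).source,
        σ * (b (γ s) * h' s) := by
  have hmeas : MeasurableSet (Ico 0 T ∩ γ ⁻¹' (chartAt (EuclideanHalfSpace 2) p).source) :=
    measurableSet_Ico.inter (hγ.isOpen_preimage p).measurableSet
  rw [← hγ.image_coord p, integral_image_eq_integral_abs_deriv_smul hmeas
    (f' := deriv fun s => (chartCoord p (γ s)).2) ?_ (hγ.injOn_coord p)]
  · refine setIntegral_congr_fun hmeas fun s hs => ?_
    obtain ⟨τ', -, hτ, h1⟩ := exists_hasDerivAt_tangential hf hfN hγ hα hα' hs.2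
    have h2 := hσ p s hs.2
    have h3 := (hh' s).unique (hγ.hasDerivAt_comp hh hs.2 hτ)
    rw [hτ.deriv, hγ.chartPar_eq hs.2, h3, ← h2, coorient_eq hγ hs.2 h1, sgn_mul, ← sgn_mul_self]
    simp only [smul_eq_mul]
    ring
  · intro s hs
    obtain ⟨τ', -, hτ, -⟩ := exists_hasDerivAt_tangential hf hfN hγ hα hα' hs.2
    exact hτ.differentiableAt.hasDerivAt.hasDerivWithinAt

/-- Stokes' theorem: if `∑ dg_k ∧ dh_k = 0` on the surface, then the integral of `∑ g_k dh_k` along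
the boundary vanishes. -/
theorem integral_boundary_eq_zero [CompactSpace M] [T2Space M] (hT : 0 ≤ T) {κ : Type*} [Fintype κ]
    {g h : κ → M → ℝ} (hg : ∀ k, ContMDiff (𝓡∂ 2) 𝓘(ℝ, ℝ) ∞ (g k))
    (hh : ∀ k, ContMDiff (𝓡∂ 2) 𝓘(ℝ, ℝ) ∞ (h k)) {h' : κ → ℝ → ℝ}
    (hh' : ∀ k s, HasDerivAt (fun s => h k (γ s)) (h' k s) s) (hc' : ∀ k, Continuous (h' k))
    (hclosed : ∀ p : M, ∀ u ∈ chartDomain p, ∑ k, wedge (chartDomain p) (g k ∘ chartPar p)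
      (h k ∘ chartPar p) u = 0) :
    ∫ s in (0 : ℝ)..T, ∑ k, g k (γ s) * h' k s = 0 := by
  obtain ⟨σ, hσ1, hσ⟩ := exists_sgn_coorient hf hN hfN hγ hα hα'
  obtain ⟨t, φ, hφ, hsupp, hsum⟩ := exists_chartPartition (M := M)
  have hφg : ∀ k i, ContMDiff (𝓡∂ 2) 𝓘(ℝ, ℝ) ∞ (φ i * g k) := fun k i => (hφ i).mul (hg k)
  have hcont : ∀ k i, Continuous fun s => σ * ((φ i * g k) (γ s) * h' k s) := fun k i =>
    continuous_const.mul (((hφg k i).continuous.comp hγ.continuous).mul (hc' k))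
  have hbd : ∀ k, ∑ j : t, ∫ u in chartDomain (j : M), sgn (orient f N j u) *
      (φ j (chartPar j u) * wedge (chartDomain (j : M)) (g k ∘ chartPar (j : M))
        (h k ∘ chartPar (j : M)) u) = -(σ * ∫ s in (0 : ℝ)..T, g k (γ s) * h' k s) := by
    intro k
    have hterm : ∀ i : t, ∫ u in chartDomain (i : M), sgn (orient f N i u) *
        wedge (chartDomain (i : M)) ((φ i * g k) ∘ chartPar (i : M)) (h k ∘ chartPar (i : M)) u =
        -∫ s in Ico 0 T, σ * ((φ i * g k) (γ s) * h' k s) := fun i => by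
      rw [integral_wedge_chart hf hN hfN (hφg k i) (hh k)
        (tsupport_mul_subset_left.trans (hsupp i)),
        integral_slice hf hfN hγ hα hα' hσ (hh k) (hh' k),
        setIntegral_eq_of_subset_of_forall_sdiff_eq_zero measurableSet_Ico inter_subset_left]
      intro s hs
      have : γ s ∉ tsupport (φ i) := fun hq => hs.2 ⟨hs.1, hsupp i hq⟩
      rw [Pi.mul_apply, image_eq_zero_of_notMem_tsupport this]
      ring
    rw [← sum_integral_wedge hf hN hfN hφ hsupp hsum (hg k) (hh k),
      Finset.sum_congr rfl fun i _ => hterm i, Finset.sum_neg_distrib,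
      ← integral_finsetSum _ fun i _ =>
        ((hcont k i).continuousOn.integrableOn_Icc.mono_set Ico_subset_Icc_self),
      ← intervalIntegral.integral_const_mul, intervalIntegral.integral_of_le hT,
      integral_Ico_eq_integral_Ioc]
    congr 1
    refine integral_congr_ae (ae_of_all _ fun s => ?_)
    simp only [Pi.mul_apply]
    rw [← Finset.mul_sum, ← Finset.sum_mul, ← Finset.sum_mul, hsum, one_mul]
  have hint : ∀ k (j : t), IntegrableOn (fun u => sgn (orient f N j u) *
      (φ j (chartPar j u) * wedge (chartDomain (j : M)) (g k ∘ chartPar (j : M))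
        (h k ∘ chartPar (j : M)) u)) (chartDomain (j : M)) := fun k j =>
    integrableOn_of_notMem (isHalfOpen_chartDomain _).measurableSet
      (isCompact_chartCoord_image (hsupp j)) (chartCoord_image_subset (hsupp j))
      ((contDiffOn_sgn_orient hf hN hfN _).continuousOn.mul
        ((contDiffOn_comp_chartPar _ (hφ j)).continuousOn.mul
          (continuousOn_wedge (isHalfOpen_chartDomain _) (contDiffOn_comp_chartPar _ (hg k))
            (contDiffOn_comp_chartPar _ (hh k)))))
      fun u hu huK => by
        rw [image_eq_zero_of_notMem_tsupport (notMem_tsupport_of_notMem_image hu huK)]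
        ring
  have hzero : ∑ k, -(σ * ∫ s in (0 : ℝ)..T, g k (γ s) * h' k s) = 0 := by
    rw [← Finset.sum_congr rfl fun k _ => hbd k, Finset.sum_comm]
    refine Finset.sum_eq_zero fun j _ => ?_
    rw [← integral_finsetSum _ fun k _ => hint k j]
    refine setIntegral_eq_zero_of_forall_eq_zero fun u hu => ?_
    rw [← Finset.mul_sum, ← Finset.mul_sum, hclosed _ u hu]
    ring
  rw [Finset.sum_neg_distrib, neg_eq_zero, ← Finset.mul_sum] at hzero
  have hi : ∀ k ∈ Finset.univ, IntervalIntegrable (fun s => g k (γ s) * h' k s) volume 0 T :=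
    fun k _ => Continuous.intervalIntegrable
      (((hg k).continuous.comp hγ.continuous).mul (hc' k)) _ _
  rw [intervalIntegral.integral_finsetSum hi]
  refine (mul_eq_zero.1 hzero).resolve_left ?_
  rintro rfl
  simp at hσ1

end Stokes

/-! ### The flux form in Sol -/

theorem metric_self_eq_zero {p w : Sol} (h : metric p w w = 0) : w = 0 := by
  have h0 : 0 ≤ exp (2 * p 2) * (w 0 * w 0) := mul_nonneg (exp_pos _).le (mul_self_nonneg _)
  have h1 : 0 ≤ exp (-(2 * p 2)) * (w 1 * w 1) := mul_nonneg (exp_pos _).le (mul_self_nonneg _)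
  have h2 : 0 ≤ w 2 * w 2 := mul_self_nonneg _
  unfold metric at h
  funext i
  fin_cases i
  · have : exp (2 * p 2) * (w 0 * w 0) = 0 := by linarith
    simpa [(exp_pos (2 * p 2)).ne'] using this
  · have : exp (-(2 * p 2)) * (w 1 * w 1) = 0 := by linarith
    simpa [(exp_pos (-(2 * p 2))).ne'] using this
  · have : w 2 * w 2 = 0 := by linarith
    simpa using this

theorem exp_mul_exp_neg (x : ℝ) : exp x * exp (-x) = 1 := by
  rw [← exp_add, add_neg_cancel, exp_zero]

/-- The Gram determinant of two vectors orthogonal to a unit vector. -/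
theorem sq_det3_eq {p n v w : Sol} (hn : metric p n n = 1) (hv : metric p n v = 0)
    (hw : metric p n w = 0) :
    det3 n v w ^ 2 = metric p v v * metric p w w - metric p v w ^ 2 := by
  have he := exp_mul_exp_neg (2 * p 2)
  -- The Gram determinant of three vectors is `det3 ^ 2` times the determinant of the metric, which
  -- is `e^{2z} e^{-2z} = 1`.
  have hgram : det3 n v w ^ 2 =
      metric p n n * (metric p v v * metric p w w - metric p v w ^ 2) -
      metric p n v * (metric p n v * metric p w w - metric p v w * metric p n w) +
      metric p n w * (metric p n v * metric p v w - metric p v v * metric p n w) := by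
    simp only [det3, metric]
    generalize exp (2 * p 2) = a at he
    generalize exp (-(2 * p 2)) = b at he
    linear_combination (-(n 0 * (v 1 * w 2 - v 2 * w 1) - n 1 * (v 0 * w 2 - v 2 * w 0)
      + n 2 * (v 0 * w 1 - v 1 * w 0)) ^ 2) * he
  rw [hgram, hn, hv, hw]
  ring

/-- The defining properties of a surface with shape operator `![![s₀₀, s₀₁], ![s₁₀, s₁₁]]` give the
closedness of the flux form. -/
theorem flux_closed {p n F₀ F₁ N₀ N₁ : Sol} {a b c d H : ℝ} (h0 : metric p n F₀ = 0)
    (h1 : metric p n F₁ = 0) (hN₀ : -N₀ - christoffel p F₀ n = a • F₀ + b • F₁)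
    (hN₁ : -N₁ - christoffel p F₁ n = c • F₀ + d • F₁) (hH : (a + d) / 2 = H) :
    ((N₀ 1 + 2 * H * F₀ 1) * F₁ 2 - (N₁ 1 + 2 * H * F₁ 1) * F₀ 2) +
      (-N₀ 2 * F₁ 1 - -N₁ 2 * F₀ 1) = 0 := by
  have e01 := congrFun hN₀ 1
  have e02 := congrFun hN₀ 2
  have e11 := congrFun hN₁ 1
  have e12 := congrFun hN₁ 2
  simp only [christoffel, metric, Pi.sub_apply, Pi.neg_apply, Pi.add_apply, Pi.smul_apply,
    smul_eq_mul, Matrix.cons_val_one, Matrix.cons_val, Matrix.cons_val_zero] at *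
  subst hH
  -- The terms with `a, b, c, d` add up to the trace times `dy ∧ dz` on `(F₀, F₁)`, which the `2H`
  -- terms cancel. Orthogonality of `n` to `F₀` and `F₁` disposes of the Christoffel terms.
  linear_combination (-F₁ 2) * e01 + F₀ 2 * e11 + F₁ 1 * e02 - F₀ 1 * e12 - F₁ 1 * h0 + F₀ 1 * h1

/-- The flux through a curve is bounded by its length, weighted by the length of `∂/∂x`. -/
theorem abs_flux_le {p n v : Sol} (hn : metric p n n = 1) (hv : metric p v v = 1) :
    |n 1 * v 2 - n 2 * v 1| ≤ exp (p 2) := by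
  have he := exp_mul_exp_neg (p 2)
  have h2 : exp (2 * p 2) = exp (p 2) ^ 2 := by rw [← exp_nat_mul]; norm_num
  have h2' : exp (-(2 * p 2)) = exp (-p 2) ^ 2 := by
    rw [← exp_nat_mul]; congr 1; push_cast; ring
  have hpos := exp_pos (p 2)
  simp only [metric, h2, h2'] at hn hv
  generalize exp (p 2) = a at *
  generalize exp (-p 2) = b at *
  refine abs_le_of_sq_le_sq ?_ hpos.le
  have hn' : (b * n 1) ^ 2 + n 2 ^ 2 ≤ 1 := by nlinarith [sq_nonneg (a * n 0)]
  have hv' : (b * v 1) ^ 2 + v 2 ^ 2 ≤ 1 := by nlinarith [sq_nonneg (a * v 0)]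
  -- Lagrange's identity: the squared determinant plus the squared inner product of two plane
  -- vectors of length at most `1` is the product of their squared lengths.
  have hcs : (b * n 1 * v 2 - n 2 * (b * v 1)) ^ 2 ≤ 1 := by
    nlinarith [sq_nonneg (b * n 1 * (b * v 1) + n 2 * v 2),
      mul_nonneg (sub_nonneg.2 hn') (sub_nonneg.2 hv')]
  calc (n 1 * v 2 - n 2 * v 1) ^ 2 = a ^ 2 * (b * n 1 * v 2 - n 2 * (b * v 1)) ^ 2 := by
        linear_combination (-(a * b + 1) * (n 1 * v 2 - n 2 * v 1) ^ 2) * he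
    _ ≤ a ^ 2 * 1 := by gcongr
    _ = a ^ 2 := mul_one _

section Surface

variable {M : Type*} [TopologicalSpace M] [ChartedSpace (EuclideanHalfSpace 2) M]
  [IsManifold (𝓡∂ 2) ∞ M] {f N : M → Sol}

/-- If the determinant vanished, so would the Gram determinant of the two tangent vectors `v`, `w`.
Then `⟨w,w⟩ v - ⟨v,w⟩ w` has length zero, against the injectivity of the differential. -/
theorem orient_ne_zero (hf : IsSmoothImmersion (𝓡∂ 2) f) (hN : IsUnitNormal (𝓡∂ 2) f N) (p : M)
    {u : ℝ × ℝ} (hu : u ∈ chartDomain p) : orient f N p u ≠ 0 := by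
  obtain ⟨J, hJ, hder⟩ := exists_chartFrame p hu
  intro h
  have hn : metric (f (chartPar p u)) (N (chartPar p u)) (N (chartPar p u)) = 1 := by
    have := hN.2.1 (chartPar p u)
    rwa [length, Real.sqrt_eq_one] at this
  have hgram := sq_det3_eq hn (hN.2.2 _ (J (1, 0))) (hN.2.2 _ (J (0, 1)))
  rw [orient, hder f hf.1, hder f hf.1] at h
  rw [h] at hgram
  set v := differential (𝓡∂ 2) f (chartPar p u) (J (1, 0)) with hv
  set w := differential (𝓡∂ 2) f (chartPar p u) (J (0, 1)) with hw
  set m := metric (f (chartPar p u)) with hm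
  have hL : Function.Injective fun x => differential (𝓡∂ 2) f (chartPar p u) (J x) :=
    (hf.2 _).comp hJ.1
  have hlin : ∀ x : ℝ × ℝ, differential (𝓡∂ 2) f (chartPar p u) (J x) = x.1 • v + x.2 • w :=
    fun x => by rw [hv, hw, ← hder f hf.1, ← hder f hf.1, ← hder f hf.1, ← apply_eq_fst_snd]
  have hzero : m (m w w • v + (-m v w) • w) (m w w • v + (-m v w) • w) = 0 := by
    have : m (m w w • v + (-m v w) • w) (m w w • v + (-m v w) • w)
        = m w w * (m v v * m w w - m v w ^ 2) := by
      simp only [hm, metric, Pi.add_apply, Pi.smul_apply, smul_eq_mul]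
      ring
    rw [this, ← hgram]; ring
  have h1 := metric_self_eq_zero hzero
  have h2 := hL (a₁ := (m w w, -m v w)) (a₂ := 0) (by
    simp only
    rw [hlin, hlin, h1]; simp)
  have h3 : w = 0 := metric_self_eq_zero (congrArg Prod.fst h2)
  have h4 := hL (a₁ := (0, 1)) (a₂ := 0) (by
    simp only
    rw [hlin, hlin, h3]; simp)
  exact one_ne_zero (congrArg Prod.snd h4)

theorem fderivWithin_apply_comp {a : M → Sol} (ha : ContMDiff (𝓡∂ 2) 𝓘(ℝ, Sol) ∞ a) {p : M}
    {u : ℝ × ℝ} (hu : u ∈ chartDomain p) (k : Fin 3) :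
    HasFDerivWithinAt (fun u => a (chartPar p u) k)
      ((ContinuousLinearMap.proj (R := ℝ) k).comp
        (fderivWithin ℝ (a ∘ chartPar p) (chartDomain p) u)) (chartDomain p) u :=
  hasFDerivWithinAt_pi'.1
    ((contDiffOn_comp_chartPar p ha).differentiableOn (by simp) u hu).hasFDerivWithinAt k

theorem trace_eq (L : (ℝ × ℝ) →ₗ[ℝ] (ℝ × ℝ)) :
    LinearMap.trace ℝ (ℝ × ℝ) L = (L (1, 0)).1 + (L (0, 1)).2 := by
  rw [LinearMap.trace_eq_matrix_trace ℝ (Module.Basis.finTwoProd ℝ), Matrix.trace_fin_two]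
  simp [LinearMap.toMatrix_apply]

/-- On a surface of constant mean curvature `H`, the flux form `(N₁ + 2H y) dz - N₂ dy` is
closed. -/
theorem wedge_flux (hf : IsSmoothImmersion (𝓡∂ 2) f) (hN : IsUnitNormal (𝓡∂ 2) f N) {H : ℝ}
    (hH : ∀ p, HasMeanCurvatureAt (𝓡∂ 2) f N p H) (p : M) {u : ℝ × ℝ} (hu : u ∈ chartDomain p) :
    wedge (chartDomain p) ((fun q => N q 1 + 2 * H * f q 1) ∘ chartPar p)
        ((fun q => f q 2) ∘ chartPar p) u +
      wedge (chartDomain p) ((fun q => -N q 2) ∘ chartPar p) ((fun q => f q 1) ∘ chartPar p) u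
      = 0 := by
  obtain ⟨J, hJ, hder⟩ := exists_chartFrame p hu
  obtain ⟨S, hS, htr⟩ := hH (chartPar p u)
  set e := LinearEquiv.ofBijective J hJ with he
  -- The shape operator is conjugated to the coordinate plane, where its trace is the sum of two
  -- explicit entries.
  set S' : (ℝ × ℝ) →ₗ[ℝ] (ℝ × ℝ) := e.symm.conj S with hS'
  have hS'J : ∀ v, J (S' v) = S (J v) := fun v => by
    rw [hS', LinearEquiv.conj_apply_apply, LinearEquiv.symm_symm]
    exact e.apply_symm_apply _
  have htr' : ((S' (1, 0)).1 + (S' (0, 1)).2) / 2 = H := by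
    rw [← trace_eq, hS', LinearMap.trace_conj', htr]
  have hud := (isHalfOpen_chartDomain p).uniqueDiffOn u hu
  have hshape : ∀ v, -fderivWithin ℝ (N ∘ chartPar p) (chartDomain p) u v -
      christoffel (f (chartPar p u)) (fderivWithin ℝ (f ∘ chartPar p) (chartDomain p) u v)
        (N (chartPar p u)) =
      (S' v).1 • fderivWithin ℝ (f ∘ chartPar p) (chartDomain p) u (1, 0) +
      (S' v).2 • fderivWithin ℝ (f ∘ chartPar p) (chartDomain p) u (0, 1) := fun v => by
    rw [← apply_eq_fst_snd, hder f hf.1 (S' v), hS'J, hS (J v), covDerivAlong, hder N hN.1,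
      hder f hf.1]
    abel
  have hperp : ∀ v, metric (f (chartPar p u)) (N (chartPar p u))
      (fderivWithin ℝ (f ∘ chartPar p) (chartDomain p) u v) = 0 := fun v => by
    rw [hder f hf.1]; exact hN.2.2 _ _
  have key := flux_closed (hperp (1, 0)) (hperp (0, 1)) (hshape (1, 0)) (hshape (0, 1)) htr'
  have d1 : fderivWithin ℝ ((fun q => N q 1 + 2 * H * f q 1) ∘ chartPar p) (chartDomain p) u = _ :=
    ((fderivWithin_apply_comp hN.1 hu 1).add
      ((fderivWithin_apply_comp hf.1 hu 1).const_mul (2 * H))).fderivWithin hud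
  have d2 : fderivWithin ℝ ((fun q => f q 2) ∘ chartPar p) (chartDomain p) u = _ :=
    (fderivWithin_apply_comp hf.1 hu 2).fderivWithin hud
  have d3 : fderivWithin ℝ ((fun q => -N q 2) ∘ chartPar p) (chartDomain p) u = _ :=
    (fderivWithin_apply_comp hN.1 hu 2).neg.fderivWithin hud
  have d4 : fderivWithin ℝ ((fun q => f q 1) ∘ chartPar p) (chartDomain p) u = _ :=
    (fderivWithin_apply_comp hf.1 hu 1).fderivWithin hud
  rw [wedge, wedge, d1, d2, d3, d4]
  exact key

end Surface

end SolGeometry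

/-! ### The mean curvature estimate -/

theorem corollary2p3 {M : Type*} [TopologicalSpace M] [T2Space M] [CompactSpace M]
    [ChartedSpace (EuclideanHalfSpace 2) M] [IsManifold (𝓡∂ 2) ∞ M]
    (c : ℝ) (hc : 1 < c) (Γ : Set SolGeometry.Sol) (hΓ : SolGeometry.IsCircleInP c Γ)
    (f : M → SolGeometry.Sol) (hf : SolGeometry.IsSmoothImmersion (𝓡∂ 2) f)
    (hbd : SolGeometry.Spans (𝓡∂ 2) f Γ)
    (H : ℝ) (hH : SolGeometry.HasConstantMeanCurvature (𝓡∂ 2) f H) :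
    |H| ≤ (c + 1) / (c - 1) * ((c + Real.sqrt (c ^ 2 - 1)) / 2) := by
  open SolGeometry in
  obtain ⟨α, T, hT, hα, hper, hinj, rfl, hP, hunit, hcurv⟩ := hΓ
  obtain ⟨N, hN, hHN⟩ := hH
  obtain ⟨γ, hγ⟩ := IsBoundaryLift.exists_of_bijOn hf.1.continuous hT hα.continuous hper hinj hbd
  have hmet : ∀ s, metric (α s) (deriv α s) (deriv α s) = 1 := fun s => by
    have := hunit s
    rwa [length, Real.sqrt_eq_one] at this
  have hα' : ∀ s, deriv α s ≠ 0 := fun s h => by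
    have := hmet s
    simp [h, metric] at this
  have hnmet : ∀ s, metric (α s) (N (γ s)) (N (γ s)) = 1 := fun s => by
    have := hN.2.1 (γ s)
    rwa [length, Real.sqrt_eq_one, hγ.map_eq] at this
  have cf : ∀ i, ContMDiff (𝓡∂ 2) 𝓘(ℝ, ℝ) ∞ fun q => f q i := contMDiff_pi_space.1 hf.1
  have cN : ∀ i, ContMDiff (𝓡∂ 2) 𝓘(ℝ, ℝ) ∞ fun q => N q i := contMDiff_pi_space.1 hN.1
  have dα : ∀ i s, HasDerivAt (fun s => f (γ s) i) (deriv α s i) s := fun i s => by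
    simp only [hγ.map_eq]
    exact hasDerivAt_pi.1 ((hα.differentiable (by simp)) s).hasDerivAt i
  have cα : ∀ i, Continuous fun s => α s i := fun i => (continuous_apply i).comp hα.continuous
  have cα' : ∀ i, Continuous fun s => deriv α s i := fun i =>
    (continuous_apply i).comp (contDiff_infty_iff_deriv.1 hα).2.continuous
  have cNγ : ∀ i, Continuous fun s => N (γ s) i := fun i => (cN i).continuous.comp hγ.continuous
  have hstokes := integral_boundary_eq_zero hf.1 hN.1 (fun p u hu => orient_ne_zero hf hN p hu)
    hγ hα hα' hT.le (κ := Fin 2)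
    (g := ![fun q => N q 1 + 2 * H * f q 1, fun q => -N q 2])
    (h := ![fun q => f q 2, fun q => f q 1])
    (h' := ![fun s => deriv α s 2, fun s => deriv α s 1])
    (Fin.forall_fin_two.2 ⟨(cN 1).add (contMDiff_const.mul (cf 1)), (cN 2).neg⟩)
    (Fin.forall_fin_two.2 ⟨cf 2, cf 1⟩) (Fin.forall_fin_two.2 ⟨dα 2, dα 1⟩)
    (Fin.forall_fin_two.2 ⟨cα' 2, cα' 1⟩) fun p u hu => by
      rw [Fin.sum_univ_two]
      exact wedge_flux hf hN hHN p hu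
  have hsplit : ∀ s, ∑ k : Fin 2, (![fun q => N q 1 + 2 * H * f q 1, fun q => -N q 2] : Fin 2 → M → ℝ)
      k (γ s) * (![fun s => deriv α s 2, fun s => deriv α s 1] : Fin 2 → ℝ → ℝ) k s =
      (N (γ s) 1 * deriv α s 2 - N (γ s) 2 * deriv α s 1) + 2 * H * (α s 1 * deriv α s 2) :=
    fun s => by
      rw [Fin.sum_univ_two]
      simp only [Matrix.cons_val_zero, Matrix.cons_val_one, hγ.map_eq]
      ring
  simp only [hsplit] at hstokes
  have cflux : Continuous fun s => N (γ s) 1 * deriv α s 2 - N (γ s) 2 * deriv α s 1 :=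
    ((cNγ 1).mul (cα' 2)).sub ((cNγ 2).mul (cα' 1))
  have carea : Continuous fun s => 2 * H * (α s 1 * deriv α s 2) :=
    continuous_const.mul ((cα 1).mul (cα' 2))
  rw [intervalIntegral.integral_add (cflux.intervalIntegrable _ _) (carea.intervalIntegrable _ _),
    intervalIntegral.integral_const_mul] at hstokes
  have hexp : Continuous fun s => Real.exp (α s 2) := (cα 2).rexp
  have hle : |∫ s in (0 : ℝ)..T, (N (γ s) 1 * deriv α s 2 - N (γ s) 2 * deriv α s 1)| ≤
      ∫ s in (0 : ℝ)..T, Real.exp (α s 2) :=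
    (intervalIntegral.abs_integral_le_integral_abs hT.le).trans
      (intervalIntegral.integral_mono_on hT.le (cflux.abs.intervalIntegrable _ _)
        (hexp.intervalIntegrable _ _) fun s _ => abs_flux_le (hnmet s) (hmet s))
  have hpos : 0 < ∫ s in (0 : ℝ)..T, Real.exp (α s 2) :=
    intervalIntegral.intervalIntegral_pos_of_pos (hexp.intervalIntegrable _ _)
      (fun s => Real.exp_pos _) hT
  have hr0 : 0 < c ^ 2 - 1 := by nlinarith
  have hr : Real.sqrt (c ^ 2 - 1) ^ 2 = c ^ 2 - 1 := Real.sq_sqrt hr0.le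
  have hrpos := Real.sqrt_pos.2 hr0
  set r := Real.sqrt (c ^ 2 - 1) with hrdef
  have hl0 : 0 < c - r := by nlinarith
  have hl1 : c - r < 1 := by nlinarith
  -- `l = c - r` is the root of `l² + 1 = 2cl` lying in `(0, 1)`. Its inverse is `c + r`, which
  -- later turns `2|H| l ≤ 1` into the bound.
  have hcirc := abs_integral_eq_of_circle (l := c - r) hc hl0 hl1 (by linear_combination hr) hα hT.le
    hper hP hunit hcurv
  set L := ∫ s in (0 : ℝ)..T, Real.exp (α s 2)
  have h1 : 2 * |H| * ((c - r) * L) ≤ L := by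
    rw [← hcirc]
    calc 2 * |H| * |∫ s in (0 : ℝ)..T, α s 1 * deriv α s 2|
        = |2 * H * ∫ s in (0 : ℝ)..T, α s 1 * deriv α s 2| := by
          rw [abs_mul, abs_mul, abs_two]
      _ = |∫ s in (0 : ℝ)..T, (N (γ s) 1 * deriv α s 2 - N (γ s) 2 * deriv α s 1)| := by
          rw [eq_neg_of_add_eq_zero_left hstokes, abs_neg]
      _ ≤ L := hle
  have h2 : 2 * |H| * (c - r) ≤ 1 := by
    by_contra hcon
    push Not at hcon
    nlinarith
  have h3 : |H| ≤ (c + r) / 2 := by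
    have : 2 * |H| * (c - r) * (c + r) ≤ 1 * (c + r) := by gcongr
    nlinarith
  have h4 : 1 ≤ (c + 1) / (c - 1) := by
    rw [le_div_iff₀ (by linarith)]; linarith
  calc |H| ≤ 1 * ((c + r) / 2) := by linarith
    _ ≤ (c + 1) / (c - 1) * ((c + r) / 2) := by gcongr
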